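/- Let $(X_n)_{n\ge 0}$ and $(\varepsilon_n)_{n\ge 0}$ be two independent sequences of independent and identically distributed real random variables, let $\theta\in\mathbb{R}$ with $|\theta|<1/4$, and let $$Y_n=f(X_n-\theta)+\varepsilon_n,\qquad n\ge 0,$$ where $\varepsilon_n$ has mean zero and finite variance $\sigma^2>0$. Assume: - $(\mathcal H_1)$ $X_n$ has a probability density $g$ which vanishes outside $[-1/2,1/2]$, is positive and continuous on $[-1/2,1/2]$, and is twice differentiable on $(-1/2,1/2)$ with bounded first and second derivatives there. - $(\mathcal H_2)$ the measurable function $f:\mathbb{R}\to\mathbb{R}$ is symmetric (that is, even), bounded and periodic with period $1$, and its first Fourier coefficient $f_1=\int_{-1/2}^{1/2}\cos(2\pi x)f(x)\,dx$ is nonzero. Let $K:\mathbb{R}\to[0,\infty)$ be an even Lipschitz function with compact support, $\int_{\mathbb R}K(x)\,dx=1$, $\int_{\mathbb R}K^2(x)\,dx<\infty$ and $\int_{\mathbb R}x^2K(x)\,dx<\infty$. Let $0<\alpha<1$, and set $h_n=n^{-\alpha}$ and $\gamma_n=1/n$ for $n\ge1$. For $n\ge 1$ define the recursive Parzen–Rosenblatt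 estimator $$\widehat g_n(x)=\frac1n\sum_{i=1}^n\frac1{h_i}K\!\left(\frac{X_i-x}{h_i}\right).$$ Let $\pi_C$ be the projection of $\mathbb{R}$ on $C=[-1/4,1/4]$, let $\widehat\theta_0$ be a $C$-valued random variable independent of $(X_n,\varepsilon_n)_{n\ge1}$ (for instance a constant), and define, for all $n\ge0$, $$\widehat\theta_{n+1}=\pi_C\bigl(\widehat\theta_n+\operatorname{sign}(f_1)\,\gamma_{n+1}\widehat T_{n+1}\bigr),\qquad \widehat T_{n+1}=\frac{\sin(2\pi(X_{n+1}-\widehat\theta_n))}{\widehat g_n(X_{n+1})}\,Y_{n+1},$$ with the convention that $\widehat T_{n+1}=0$ if $n=0$ or $\widehat g_n(X_{n+1})=0$. Then $\widehat\theta_n$ converges almost surely to $\theta$. Moreover, almost surely, $\widehat\theta_n+\operatorname{sign}(f_1)\gamma_{n+1}\widehat T_{n+1}\notin C$ for only finitely many $n$. -/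

import Mathlib

open MeasureTheory ProbabilityTheory Filter Topology

noncomputable section

namespace ShiftModel

/-- Assumption (H1) on a real function `g`: it is positive on `[-1/2, 1/2]` and vanishes outside,
it is continuous on `[-1/2, 1/2]`, and twice differentiable inside, with bounded first and second
derivatives. (As `g` is bounded below by a positive constant on `[-1/2, 1/2]`, it necessarily jumps
at the end points, so that regularity refers to `g` on its support.) -/
structure IsDesignDensity (g : ℝ → ℝ) : Prop where
  pos : ∀ x ∈ Set.Icc (-1 / 2 : ℝ) (1 / 2), 0 < g x
  zero_outside : ∀ x ∉ Set.Icc (-1 / 2 : ℝ) (1 / 2), g x = 0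
  continuousOn : ContinuousOn g (Set.Icc (-1 / 2) (1 / 2))
  differentiableOn : DifferentiableOn ℝ g (Set.Ioo (-1 / 2) (1 / 2))
  differentiableOn_deriv : DifferentiableOn ℝ (deriv g) (Set.Ioo (-1 / 2) (1 / 2))
  bounded_deriv : ∃ M : ℝ, ∀ x ∈ Set.Ioo (-1 / 2 : ℝ) (1 / 2), |deriv g x| ≤ M
  bounded_deriv2 : ∃ M : ℝ, ∀ x ∈ Set.Ioo (-1 / 2 : ℝ) (1 / 2), |deriv (deriv g) x| ≤ M

/-- Assumption (H2) on the shape function `f`: symmetric (even), bounded, periodic with period `1`;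
measurability is part of the regression model. -/
structure IsShape (f : ℝ → ℝ) : Prop where
  measurable : Measurable f
  even : ∀ x, f (-x) = f x
  bounded : ∃ M : ℝ, ∀ x, |f x| ≤ M
  periodic : Function.Periodic f 1

/-- A smoothing kernel: symmetric, nonnegative, compactly supported, of integral one, with finite
`∫ K ^ 2` and finite second moment. -/
structure IsKernel (K : ℝ → ℝ) : Prop where
  even : ∀ x, K (-x) = K x
  nonneg : ∀ x, 0 ≤ K x
  compactSupport : HasCompactSupport K
  integrable : Integrable K
  integral_eq_one : ∫ x, K x = 1
  integrable_sq : Integrable (fun x => K x ^ 2)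
  integrable_moment : Integrable (fun x => x ^ 2 * K x)

/-- The first Fourier coefficient `f₁ = ∫_{-1/2}^{1/2} cos (2 π x) f x dx`. -/
def firstFourier (f : ℝ → ℝ) : ℝ :=
  ∫ x in (-1 / 2 : ℝ)..(1 / 2), Real.cos (2 * Real.pi * x) * f x

/-- The projection on `C = [-1/4, 1/4]`. -/
def projC (x : ℝ) : ℝ := max (-1 / 4) (min x (1 / 4))

/-- The recursive Parzen-Rosenblatt estimate built from `x 1, …, x n` with bandwidths `h`,
evaluated at `t`. -/
def densityEst (K : ℝ → ℝ) (h : ℕ → ℝ) (x : ℕ → ℝ) (n : ℕ) (t : ℝ) : ℝ :=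
  1 / (n : ℝ) * ∑ i ∈ Finset.Icc 1 n, 1 / h i * K ((x i - t) / h i)

/-- The increment `sin (2 π (x (n+1) - t)) / ĝ_n (x (n+1)) * y (n+1)`, where `t` is the current
value of the algorithm. Division by zero gives zero: no correction is made at a step at which
the density estimate vanishes at `x (n+1)`; this includes `n = 0`, where there is no estimate. -/
def increment (K : ℝ → ℝ) (h : ℕ → ℝ) (x y : ℕ → ℝ) (n : ℕ) (t : ℝ) : ℝ :=
  Real.sin (2 * Real.pi * (x (n + 1) - t)) / densityEst K h x n (x (n + 1)) * y (n + 1)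

/-- The update `t + s γ_{n+1} T̂_{n+1}` from the current value `t`, before projection. -/
def preUpdate (K : ℝ → ℝ) (h γ : ℕ → ℝ) (s : ℝ) (x y : ℕ → ℝ) (n : ℕ) (t : ℝ) : ℝ :=
  t + s * γ (n + 1) * increment K h x y n t

/-- The projected Robbins-Monro algorithm started from `t₀`, along the data `x`, `y`. -/
def estimator (K : ℝ → ℝ) (h γ : ℕ → ℝ) (s t₀ : ℝ) (x y : ℕ → ℝ) : ℕ → ℝ
  | 0 => t₀
  | n + 1 => projC (preUpdate K h γ s x y n (estimator K h γ s t₀ x y n))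

/-- The bandwidth `h_n = n ^ (-α)`. -/
def bandwidth (α : ℝ) (n : ℕ) : ℝ := (n : ℝ) ^ (-α)

/-- The step `γ_n = 1 / n`. -/
def step (n : ℕ) : ℝ := 1 / (n : ℝ)

end ShiftModel

end

/-! The proof is a Lyapunov argument for `V n = (θ̂_n - θ)²`. If the true density stood in the
denominator, the conditional mean of the increment given the past would be `f₁ sin (2π(θ - θ̂_n))`:
the density cancels, and evenness and periodicity of `f` leave only its first Fourier coefficient
(`integral_sin_mul_shift`). As `θ̂_n` lies in `C` and `|θ| < 1/4`, the error stays at distance at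
most `ρ < 1/2` from zero, where `u sin (2πu) ≥ 4 cos(πρ) u²`. The drift, with the sign of `f₁`,
therefore contracts `V`, and the projection does not increase it because it is 1-Lipschitz and fixes
`θ`. Hence `V (n+1) ≤ (1 - cγ) V n + γ η + ξ` with `ξ` the sum of a martingale difference and of `γ²
T²`, both of convergent series, and `V` tends to zero by `tendsto_zero_of_recursive_le`.

The term `η` pays for using the estimated density. It is a multiple of `∫ |g / max ĝ_n c₀ - 1|`,
which only has to vanish in the limit, without a rate. Truncating the denominator at `c₀` keeps the
increments bounded in L², and almost surely alters only finitely many of them. This rests on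
`ae_tendsto_densityEst`: pointwise convergence inside the support, and a uniform positive lower
bound up to the end points, where `g` jumps and consistency fails. Both follow from uniform
closeness of `ĝ_n` to its mean, by a Bernstein bound on a grid, the Lipschitz property of `K` and
Borel-Cantelli.

Finally `θ` is interior to `C` and `γ T → 0`, so the unprojected updates also tend to `θ` and leave
`C` only finitely often. -/

namespace ShiftModel

/-! ### Deterministic tools: comparison lemma, drift inequality, projection. -/

/-- A Robbins-Monro type comparison lemma: a nonnegative sequence that satisfies a contracting
affine recursion, up to a negligible drift and a convergent series, tends to zero. -/
theorem tendsto_zero_of_recursive_le {V γ η ξ : ℕ → ℝ} {c L : ℝ} (hc : 0 < c)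
    (hV : ∀ n, 0 ≤ V n) (hγ : ∀ n, 0 ≤ γ n) (hγ0 : Tendsto γ atTop (𝓝 0))
    (hγs : Tendsto (fun n => ∑ i ∈ Finset.range n, γ i) atTop atTop)
    (hη : Tendsto η atTop (𝓝 0))
    (hξ : Tendsto (fun n => ∑ i ∈ Finset.range n, ξ i) atTop (𝓝 L))
    (hrec : ∀ᶠ n in atTop, V (n + 1) ≤ (1 - c * γ n) * V n + γ n * η n + ξ n) :
    Tendsto V atTop (𝓝 0) := by
  -- Adding the tail `R` of the series to `V` absorbs `ξ`: `V + R` satisfies the same recursion with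
  -- the drift `η + c R`, which still tends to zero.
  set R : ℕ → ℝ := fun n => L - ∑ i ∈ Finset.range n, ξ i with hR
  have hR0 : Tendsto R atTop (𝓝 0) := by simpa [hR] using Tendsto.const_sub L hξ
  have hRs : ∀ n, R (n + 1) = R n - ξ n := fun n => by simp only [hR, Finset.sum_range_succ]; ring
  have hη' : Tendsto (fun n => η n + c * R n) atTop (𝓝 0) := by
    simpa using hη.add (hR0.const_mul c)
  have hcγ : ∀ᶠ n in atTop, c * γ n ≤ 1 := by
    have : Tendsto (fun n => c * γ n) atTop (𝓝 0) := by simpa using hγ0.const_mul c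
    exact this.eventually_le_const one_pos
  rw [tendsto_order]
  refine ⟨fun a ha => Eventually.of_forall fun n => ha.trans_le (hV n), fun δ hδ => ?_⟩
  -- Three quarters are spent: the level subtracted in `key`, the exponential bound, and `-R`.
  have hδ4 : 0 < δ / 4 := by positivity
  have hη'' : ∀ᶠ n in atTop, η n + c * R n ≤ c * (δ / 4) :=
    hη'.eventually_le_const (by positivity)
  obtain ⟨N, hN⟩ := eventually_atTop.1 ((hrec.and hcγ).and hη'')
  set B : ℝ := |V N + R N - δ / 4| with hB
  have key : ∀ k, V (N + k) + R (N + k) - δ / 4 ≤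
      B * Real.exp (-c * (∑ i ∈ Finset.range (N + k), γ i - ∑ i ∈ Finset.range N, γ i)) := by
    intro k
    induction k with
    | zero => simpa [hB] using le_abs_self (V N + R N - δ / 4)
    | succ k ih =>
      obtain ⟨⟨h1, h2⟩, h3⟩ := hN (N + k) (by omega)
      have h4 : 0 ≤ 1 - c * γ (N + k) := by linarith
      have h5 : V (N + k + 1) + R (N + k + 1) - δ / 4 ≤
          (1 - c * γ (N + k)) * (V (N + k) + R (N + k) - δ / 4) := by
        rw [hRs]
        have := mul_le_mul_of_nonneg_left h3 (hγ (N + k))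
        nlinarith
      have h6 : 1 - c * γ (N + k) ≤ Real.exp (-(c * γ (N + k))) := by
        have := Real.add_one_le_exp (-(c * γ (N + k))); linarith
      calc V (N + k + 1) + R (N + k + 1) - δ / 4
          ≤ (1 - c * γ (N + k)) * (V (N + k) + R (N + k) - δ / 4) := h5
        _ ≤ (1 - c * γ (N + k)) * (B * Real.exp (-c * (∑ i ∈ Finset.range (N + k), γ i -
              ∑ i ∈ Finset.range N, γ i))) := mul_le_mul_of_nonneg_left ih h4
        _ ≤ Real.exp (-(c * γ (N + k))) * (B * Real.exp (-c * (∑ i ∈ Finset.range (N + k), γ i -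
              ∑ i ∈ Finset.range N, γ i))) := by gcongr
        _ = _ := by
            rw [mul_left_comm, ← Real.exp_add, ← add_assoc, Finset.sum_range_succ]
            congr 2; ring
  have hexp : Tendsto (fun n => B * Real.exp (-c * (∑ i ∈ Finset.range n, γ i -
      ∑ i ∈ Finset.range N, γ i))) atTop (𝓝 0) := by
    have h1 : Tendsto (fun n => -c * (∑ i ∈ Finset.range n, γ i -
        ∑ i ∈ Finset.range N, γ i)) atTop atBot :=
      (tendsto_atTop_add_const_right _ _ hγs).const_mul_atTop_of_neg (by linarith)
    simpa using (Real.tendsto_exp_atBot.comp h1).const_mul B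
  filter_upwards [hexp.eventually_lt_const hδ4, hR0.eventually_const_lt (neg_neg_of_pos hδ4),
    eventually_ge_atTop N] with n h1 h2 h3
  obtain ⟨k, rfl⟩ := Nat.exists_eq_add_of_le h3
  have := key k
  linarith

/-- Write `sin 2πu = 2 sin πu cos πu` for `u ≥ 0`; Jordan's inequality gives `sin πu ≥ 2u`, and the
cosine decreases. The constant is positive once `ρ < 1/2`. -/
theorem mul_sin_two_pi_mul_ge {ρ u : ℝ} (hρ : ρ ≤ 1 / 2) (hu : |u| ≤ ρ) :
    4 * Real.cos (Real.pi * ρ) * u ^ 2 ≤ u * Real.sin (2 * Real.pi * u) := by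
  have hpi := Real.pi_pos
  have habs : u * Real.sin (2 * Real.pi * u) = |u| * Real.sin (2 * Real.pi * |u|) := by
    rcases abs_cases u with ⟨h, -⟩ | ⟨h, -⟩ <;> rw [h]
    rw [mul_neg, Real.sin_neg]; ring
  rw [habs, ← sq_abs u]
  have h0 := abs_nonneg u
  generalize |u| = v at *
  have h1 : 2 / Real.pi * (Real.pi * v) ≤ Real.sin (Real.pi * v) :=
    Real.mul_le_sin (by positivity) (by nlinarith)
  have h2 : Real.cos (Real.pi * ρ) ≤ Real.cos (Real.pi * v) :=
    Real.cos_le_cos_of_nonneg_of_le_pi (by positivity) (by nlinarith) (by nlinarith)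
  have h3 : 0 ≤ Real.cos (Real.pi * ρ) :=
    Real.cos_nonneg_of_neg_pi_div_two_le_of_le (by nlinarith) (by nlinarith)
  have h4 : 2 / Real.pi * (Real.pi * v) = 2 * v := by field_simp
  rw [h4] at h1
  rw [mul_assoc 2, Real.sin_two_mul]
  have h5 := mul_le_mul h1 h2 h3 (by linarith)
  nlinarith

theorem projC_mem (x : ℝ) : projC x ∈ Set.Icc (-1 / 4 : ℝ) (1 / 4) := by
  simp only [projC, Set.mem_Icc]; constructor
  · exact le_max_left _ _
  · exact max_le (by norm_num) (min_le_right _ _)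

theorem projC_of_mem {x : ℝ} (hx : x ∈ Set.Icc (-1 / 4 : ℝ) (1 / 4)) : projC x = x := by
  rw [projC, min_eq_left hx.2, max_eq_right hx.1]

theorem abs_projC_sub_projC_le (x y : ℝ) : |projC x - projC y| ≤ |x - y| := by
  have h1 := abs_max_sub_max_le_max (-1 / 4 : ℝ) (min x (1 / 4)) (-1 / 4) (min y (1 / 4))
  have h2 := abs_min_sub_min_le_max x (1 / 4) y (1 / 4)
  simp only [sub_self, abs_zero] at h1 h2
  rw [max_eq_right (a := (0 : ℝ)) (abs_nonneg _)] at h1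
  rw [max_eq_left (b := (0 : ℝ)) (abs_nonneg _)] at h2
  exact h1.trans h2

theorem continuous_projC : Continuous projC := by unfold projC; fun_prop

theorem tendsto_sum_step :
    Tendsto (fun n => ∑ i ∈ Finset.range n, step (i + 1)) atTop atTop := by
  simpa [step] using Real.tendsto_sum_range_one_div_nat_succ_atTop

/-! ### Kernels, the design density and the mean of one kernel term. -/

section Kernel

variable {K : ℝ → ℝ}

/-- The mean of the kernel smoother of bandwidth `h` at `x`, for a design of law `μ`. -/
noncomputable def kernelMean (μ : Measure ℝ) (K : ℝ → ℝ) (h x : ℝ) : ℝ :=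
  ∫ y, 1 / h * K ((y - x) / h) ∂μ

/-- The design law with density `g`. -/
noncomputable def designLaw (g : ℝ → ℝ) : Measure ℝ :=
  volume.withDensity (fun x => ENNReal.ofReal (g x))

theorem IsKernel.setIntegral_Ioi (hK : IsKernel K) : ∫ u in Set.Ioi 0, K u = 1 / 2 := by
  have h1 : ∫ u in Set.Iic 0, K u = ∫ u in Set.Ioi 0, K u := by
    have := integral_comp_neg_Ioi (0 : ℝ) K
    simp only [hK.even, neg_zero] at this
    exact this.symm
  have h2 := intervalIntegral.integral_Iic_add_Ioi (b := (0 : ℝ)) hK.integrable.integrableOn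
    hK.integrable.integrableOn
  rw [h1, hK.integral_eq_one] at h2
  linarith

theorem IsKernel.setIntegral_Iic (hK : IsKernel K) : ∫ u in Set.Iic 0, K u = 1 / 2 := by
  have h2 := intervalIntegral.integral_Iic_add_Ioi (b := (0 : ℝ)) hK.integrable.integrableOn
    hK.integrable.integrableOn
  rw [hK.setIntegral_Ioi, hK.integral_eq_one] at h2
  linarith

theorem IsKernel.exists_radius (hK : IsKernel K) : ∃ R > 0, ∀ u, R < |u| → K u = 0 := by
  obtain ⟨R, hR⟩ := hK.compactSupport.isCompact.isBounded.subset_closedBall (0 : ℝ)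
  refine ⟨max R 1, by positivity, fun u hu => image_eq_zero_of_notMem_tsupport fun hmem => ?_⟩
  have := hR hmem
  rw [mem_closedBall_zero_iff, Real.norm_eq_abs] at this
  exact absurd hu (not_lt.2 (this.trans (le_max_left _ _)))

theorem IsKernel.exists_bound (hK : IsKernel K) (hc : Continuous K) : ∃ B > 0, ∀ u, K u ≤ B := by
  obtain ⟨B, hB⟩ := hK.compactSupport.exists_bound_of_continuous hc
  exact ⟨max B 1, by positivity, fun u => (le_abs_self _).trans ((hB u).trans (le_max_left _ _))⟩

end Kernel

section Design

variable {g K : ℝ → ℝ}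

theorem IsDesignDensity.measurable (hg : IsDesignDensity g) : Measurable g := by
  have h : g = (Set.Icc (-1 / 2 : ℝ) (1 / 2)).indicator g := by
    ext x
    by_cases hx : x ∈ Set.Icc (-1 / 2 : ℝ) (1 / 2)
    · rw [Set.indicator_of_mem hx]
    · rw [Set.indicator_of_notMem hx, hg.zero_outside x hx]
  rw [h]
  have := (hg.continuousOn.measurable_piecewise (g := 0) continuousOn_const measurableSet_Icc)
  classical
  rw [← Set.piecewise_eq_indicator]
  convert this

theorem IsDesignDensity.nonneg (hg : IsDesignDensity g) (x : ℝ) : 0 ≤ g x := by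
  by_cases hx : x ∈ Set.Icc (-1 / 2 : ℝ) (1 / 2)
  · exact (hg.pos x hx).le
  · exact (hg.zero_outside x hx).ge

theorem IsDesignDensity.exists_bounds (hg : IsDesignDensity g) : ∃ g₀ > 0, ∃ G > 0,
    (∀ x ∈ Set.Icc (-1 / 2 : ℝ) (1 / 2), g₀ ≤ g x) ∧ ∀ x, g x ≤ G := by
  have hne : (Set.Icc (-1 / 2 : ℝ) (1 / 2)).Nonempty := ⟨0, by norm_num⟩
  obtain ⟨a, ha, hamin⟩ := isCompact_Icc.exists_isMinOn hne hg.continuousOn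
  obtain ⟨b, hb, hbmax⟩ := isCompact_Icc.exists_isMaxOn hne hg.continuousOn
  refine ⟨g a, hg.pos a ha, g b, hg.pos b hb, fun x hx => hamin hx, fun x => ?_⟩
  by_cases hx : x ∈ Set.Icc (-1 / 2 : ℝ) (1 / 2)
  · exact hbmax hx
  · exact (hg.zero_outside x hx).trans_le (hg.nonneg b)

theorem IsDesignDensity.integral_designLaw (hg : IsDesignDensity g) (φ : ℝ → ℝ) :
    ∫ y, φ y ∂(designLaw g) = ∫ y, g y * φ y := by
  rw [designLaw, integral_withDensity_eq_integral_toReal_smul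
    hg.measurable.ennreal_ofReal (by simp)]
  simp [ENNReal.toReal_ofReal, hg.nonneg]

theorem IsDesignDensity.integral_designLaw_eq_setIntegral (hg : IsDesignDensity g) (φ : ℝ → ℝ) :
    ∫ y, φ y ∂(designLaw g) = ∫ y in Set.Icc (-1 / 2 : ℝ) (1 / 2), g y * φ y := by
  rw [hg.integral_designLaw, setIntegral_eq_integral_of_forall_compl_eq_zero]
  intro x hx
  rw [hg.zero_outside x hx, zero_mul]

theorem IsDesignDensity.ae_mem_Icc (hg : IsDesignDensity g) :
    ∀ᵐ x ∂(designLaw g), x ∈ Set.Icc (-1 / 2 : ℝ) (1 / 2) := by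
  rw [designLaw, ae_withDensity_iff hg.measurable.ennreal_ofReal]
  refine Eventually.of_forall fun x hx => ?_
  by_contra h
  exact hx (by rw [hg.zero_outside x h, ENNReal.ofReal_zero])

theorem IsDesignDensity.kernelMean_eq (hg : IsDesignDensity g) {h : ℝ} (hh : 0 < h) (x : ℝ) :
    kernelMean (designLaw g) K h x = ∫ u, K u * g (x + h * u) := by
  rw [kernelMean, hg.integral_designLaw]
  rw [← integral_add_left_eq_self (fun y => g y * (1 / h * K ((y - x) / h))) x]
  have := Measure.integral_comp_mul_left (fun y => g (x + y) * (1 / h * K ((x + y - x) / h))) h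
  rw [abs_of_pos (inv_pos.2 hh), smul_eq_mul, eq_comm, inv_mul_eq_iff_eq_mul₀ hh.ne'] at this
  rw [this, ← integral_const_mul]
  refine integral_congr_ae (Eventually.of_forall fun u => ?_)
  simp only [add_sub_cancel_left]
  rw [mul_div_cancel_left₀ _ hh.ne']
  field_simp

theorem IsDesignDensity.integrable_kernel_mul (hg : IsDesignDensity g) (hK : IsKernel K)
    (h x : ℝ) : Integrable fun u => K u * g (x + h * u) := by
  obtain ⟨g₀, -, G, -, -, hG⟩ := hg.exists_bounds
  refine hK.integrable.mul_bdd (c := G) ?_ ?_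
  · exact (hg.measurable.comp (by fun_prop)).aestronglyMeasurable
  · refine Eventually.of_forall fun u => ?_
    rw [Real.norm_eq_abs, abs_of_nonneg (hg.nonneg _)]
    exact hG _

theorem IsDesignDensity.kernelMean_le (hg : IsDesignDensity g) (hK : IsKernel K) {G : ℝ}
    (hG : ∀ x, g x ≤ G) {h : ℝ} (hh : 0 < h) (x : ℝ) : kernelMean (designLaw g) K h x ≤ G := by
  rw [hg.kernelMean_eq hh]
  calc ∫ u, K u * g (x + h * u) ≤ ∫ u, K u * G :=
        integral_mono (hg.integrable_kernel_mul hK h x) (hK.integrable.mul_const G)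
          fun u => mul_le_mul_of_nonneg_left (hG _) (hK.nonneg u)
    _ = G := by rw [integral_mul_const, hK.integral_eq_one, one_mul]

theorem kernelMean_nonneg (μ : Measure ℝ) (hK : IsKernel K) {h : ℝ} (hh : 0 < h) (x : ℝ) :
    0 ≤ kernelMean μ K h x :=
  integral_nonneg fun _ => mul_nonneg (by positivity) (hK.nonneg _)

/-- Near an end point half of the kernel window leaves the support, but the half pointing towards
the centre stays inside and carries mass `1/2` by symmetry of `K`. -/
theorem IsDesignDensity.exists_kernelMean_ge (hg : IsDesignDensity g) (hK : IsKernel K) {g₀ : ℝ}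
    (hg₀ : ∀ x ∈ Set.Icc (-1 / 2 : ℝ) (1 / 2), g₀ ≤ g x) :
    ∃ h₀ > 0, ∀ h, 0 < h → h ≤ h₀ → ∀ x ∈ Set.Icc (-1 / 2 : ℝ) (1 / 2),
      g₀ / 2 ≤ kernelMean (designLaw g) K h x := by
  obtain ⟨R, hR, hKR⟩ := hK.exists_radius
  refine ⟨1 / (2 * R), by positivity, fun h hh hle x hx => ?_⟩
  have hhR : h * R ≤ 1 / 2 := by
    rw [le_div_iff₀ (by positivity)] at hle; linarith
  have main : ∀ s : Set ℝ, MeasurableSet s → ∫ u in s, K u = 1 / 2 →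
      (∀ u ∈ s, |u| ≤ R → x + h * u ∈ Set.Icc (-1 / 2 : ℝ) (1 / 2)) →
      g₀ / 2 ≤ kernelMean (designLaw g) K h x := by
    intro s hs hs1 hs2
    rw [hg.kernelMean_eq hh]
    calc g₀ / 2 = ∫ u in s, K u * g₀ := by rw [integral_mul_const, hs1]; ring
      _ ≤ ∫ u in s, K u * g (x + h * u) := by
          refine setIntegral_mono_on (hK.integrable.mul_const _).integrableOn
            (hg.integrable_kernel_mul hK h x).integrableOn hs fun u hu => ?_
          by_cases huR : |u| ≤ R
          · exact mul_le_mul_of_nonneg_left (hg₀ _ (hs2 u hu huR)) (hK.nonneg u)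
          · rw [hKR u (not_le.1 huR), zero_mul, zero_mul]
      _ ≤ ∫ u, K u * g (x + h * u) := setIntegral_le_integral (hg.integrable_kernel_mul hK h x)
          (Eventually.of_forall fun u => mul_nonneg (hK.nonneg u) (hg.nonneg _))
  have bd : ∀ u, |u| ≤ R → |h * u| ≤ 1 / 2 := fun u hu => by
    rw [abs_mul, abs_of_pos hh]; exact (mul_le_mul_of_nonneg_left hu hh.le).trans hhR
  rcases le_total x 0 with hx0 | hx0
  · refine main _ measurableSet_Ioi hK.setIntegral_Ioi fun u hu huR => ?_
    have h1 := abs_le.1 (bd u huR)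
    have h2 : 0 ≤ h * u := mul_nonneg hh.le (le_of_lt hu)
    exact ⟨by linarith [hx.1], by linarith⟩
  · refine main _ measurableSet_Iic hK.setIntegral_Iic fun u hu huR => ?_
    have h1 := abs_le.1 (bd u huR)
    have h2 : h * u ≤ 0 := mul_nonpos_of_nonneg_of_nonpos hh.le hu
    exact ⟨by linarith, by linarith [hx.2]⟩

/-- Dominated convergence after rescaling. Interior points only, as `g` jumps at the end points. -/
theorem IsDesignDensity.tendsto_kernelMean (hg : IsDesignDensity g) (hK : IsKernel K) {h : ℕ → ℝ}
    (hh : ∀ᶠ n in atTop, 0 < h n) (hh0 : Tendsto h atTop (𝓝 0)) {x : ℝ}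
    (hx : x ∈ Set.Ioo (-1 / 2 : ℝ) (1 / 2)) :
    Tendsto (fun n => kernelMean (designLaw g) K (h n) x) atTop (𝓝 (g x)) := by
  obtain ⟨g₀, -, G, -, -, hG⟩ := hg.exists_bounds
  have hcont : ContinuousAt g x := hg.continuousOn.continuousAt (Icc_mem_nhds hx.1 hx.2)
  have hlim : Tendsto (fun n => ∫ u, K u * g (x + h n * u)) atTop (𝓝 (∫ u, K u * g x)) := by
    refine tendsto_integral_of_dominated_convergence (fun u => K u * G)
      (fun n => (hg.integrable_kernel_mul hK (h n) x).aestronglyMeasurable)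
      (hK.integrable.mul_const G) (fun n => Eventually.of_forall fun u => ?_)
      (Eventually.of_forall fun u => ?_)
    · rw [Real.norm_eq_abs, abs_of_nonneg (mul_nonneg (hK.nonneg u) (hg.nonneg _))]
      exact mul_le_mul_of_nonneg_left (hG _) (hK.nonneg u)
    · have h1 : Tendsto (fun n => x + h n * u) atTop (𝓝 x) := by
        simpa using (hh0.mul_const u).const_add x
      exact (hcont.tendsto.comp h1).const_mul (K u)
  rw [integral_mul_const, hK.integral_eq_one, one_mul] at hlim
  refine hlim.congr' ?_
  filter_upwards [hh] with n hn
  rw [hg.kernelMean_eq hn]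

end Design

/-! ### Bandwidths and the mean of the recursive estimate. -/

theorem bandwidth_pos {α : ℝ} {n : ℕ} (hn : 1 ≤ n) : 0 < bandwidth α n :=
  Real.rpow_pos_of_pos (by exact_mod_cast hn) _

theorem tendsto_bandwidth {α : ℝ} (hα : 0 < α) : Tendsto (bandwidth α) atTop (𝓝 0) :=
  (tendsto_rpow_neg_atTop hα).comp tendsto_natCast_atTop_atTop

theorem one_div_bandwidth_le {α : ℝ} (hα : 0 ≤ α) {i n : ℕ} (hin : i ≤ n) :
    1 / bandwidth α i ≤ (n : ℝ) ^ α := by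
  rw [bandwidth, Real.rpow_neg (Nat.cast_nonneg _), one_div, inv_inv]
  exact Real.rpow_le_rpow (by positivity) (by exact_mod_cast hin) hα

/-- The mean of the recursive density estimate. -/
noncomputable def meanEst (μ : Measure ℝ) (K : ℝ → ℝ) (h : ℕ → ℝ) (n : ℕ) (x : ℝ) : ℝ :=
  1 / (n : ℝ) * ∑ i ∈ Finset.Icc 1 n, kernelMean μ K (h i) x

theorem tendsto_average_Icc {u : ℕ → ℝ} {l : ℝ} (hu : Tendsto u atTop (𝓝 l)) :
    Tendsto (fun n : ℕ => 1 / (n : ℝ) * ∑ i ∈ Finset.Icc 1 n, u i) atTop (𝓝 l) := by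
  have h := (hu.comp (tendsto_add_atTop_nat 1)).cesaro
  refine h.congr fun n => ?_
  simp only [Function.comp_apply]
  rw [one_div, Finset.range_eq_Ico, Finset.sum_Ico_add' u 0 n 1]
  congr 1

theorem IsDesignDensity.tendsto_meanEst {g K : ℝ → ℝ} (hg : IsDesignDensity g) (hK : IsKernel K)
    {α : ℝ} (hα : 0 < α) {x : ℝ} (hx : x ∈ Set.Ioo (-1 / 2 : ℝ) (1 / 2)) :
    Tendsto (fun n => meanEst (designLaw g) K (bandwidth α) n x) atTop (𝓝 (g x)) :=
  tendsto_average_Icc <| hg.tendsto_kernelMean hK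
    ((eventually_ge_atTop 1).mono fun _ => bandwidth_pos) (tendsto_bandwidth hα) hx

theorem IsDesignDensity.eventually_meanEst_ge {g K : ℝ → ℝ} (hg : IsDesignDensity g)
    (hK : IsKernel K) {α : ℝ} (hα : 0 < α) {g₀ : ℝ} (hg₀pos : 0 < g₀)
    (hg₀ : ∀ x ∈ Set.Icc (-1 / 2 : ℝ) (1 / 2), g₀ ≤ g x) :
    ∀ᶠ n in atTop, ∀ x ∈ Set.Icc (-1 / 2 : ℝ) (1 / 2),
      g₀ / 4 ≤ meanEst (designLaw g) K (bandwidth α) n x := by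
  obtain ⟨h₀, hh₀, H⟩ := hg.exists_kernelMean_ge hK hg₀
  obtain ⟨N, hN⟩ := eventually_atTop.1 ((tendsto_bandwidth hα).eventually_le_const hh₀)
  -- Early bandwidths are too wide for the lower bound, so their terms are only bounded by zero. The
  -- average still tends to `g₀ / 2`, hence eventually exceeds `g₀ / 4`.
  let u : ℕ → ℝ := fun i => if N ≤ i then g₀ / 2 else 0
  have hu : Tendsto u atTop (𝓝 (g₀ / 2)) :=
    tendsto_const_nhds.congr' <| (eventually_ge_atTop N).mono fun n hn => by simp [u, hn]
  filter_upwards [(tendsto_average_Icc hu).eventually_const_le (show g₀ / 4 < g₀ / 2 by linarith)]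
    with n hn x hx
  refine hn.trans (mul_le_mul_of_nonneg_left (Finset.sum_le_sum fun i hi => ?_) (by positivity))
  have hi1 := (Finset.mem_Icc.1 hi).1
  by_cases hNi : N ≤ i
  · simpa [u, hNi] using H _ (bandwidth_pos hi1) (hN i hNi) x hx
  · simpa [u, hNi] using kernelMean_nonneg _ hK (bandwidth_pos hi1) x

/-! ### Exponential deviation inequalities. -/

section Chernoff

variable {Ω : Type*} [MeasurableSpace Ω] {P : Measure Ω} [IsProbabilityMeasure P]

/-- Integrate `exp x ≤ 1 + x + x²`, valid for `|x| ≤ 1`; the linear term is centered. -/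
theorem mgf_le_exp_of_centered {U : Ω → ℝ} (hm : Measurable U) {b v t : ℝ} (ht : 0 ≤ t)
    (htb : t * b ≤ 1) (hb : ∀ ω, |U ω| ≤ b) (h0 : ∫ ω, U ω ∂P = 0) (hv : ∫ ω, U ω ^ 2 ∂P ≤ v) :
    mgf U P t ≤ Real.exp (t ^ 2 * v) := by
  have hint : Integrable U P := Integrable.of_bound hm.aestronglyMeasurable b
    (Eventually.of_forall hb)
  have hint2 : Integrable (fun ω => U ω ^ 2) P :=
    Integrable.of_bound (hm.pow_const 2).aestronglyMeasurable (b ^ 2)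
      (Eventually.of_forall fun ω => by
        rw [Real.norm_eq_abs, abs_pow]; exact pow_le_pow_left₀ (abs_nonneg _) (hb ω) 2)
  have habs : ∀ ω, |t * U ω| ≤ 1 := fun ω => by
    rw [abs_mul, abs_of_nonneg ht]
    exact (mul_le_mul_of_nonneg_left (hb ω) ht).trans htb
  have hexp : Integrable (fun ω => Real.exp (t * U ω)) P :=
    Integrable.of_bound (by fun_prop) (Real.exp 1) (Eventually.of_forall fun ω => by
      rw [Real.norm_eq_abs, Real.abs_exp]
      exact Real.exp_le_exp.2 ((le_abs_self _).trans (habs ω)))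
  calc mgf U P t = ∫ ω, Real.exp (t * U ω) ∂P := rfl
    _ ≤ ∫ ω, (1 + t * U ω + t ^ 2 * U ω ^ 2) ∂P := by
        refine integral_mono hexp (((integrable_const 1).add (hint.const_mul t)).add
          (hint2.const_mul (t ^ 2))) fun ω => ?_
        have := (abs_le.1 (Real.abs_exp_sub_one_sub_id_le (habs ω))).2
        simp only
        nlinarith
    _ = 1 + t ^ 2 * ∫ ω, U ω ^ 2 ∂P := by
        have h1 := integral_add ((integrable_const (1 : ℝ)).add (hint.const_mul t))
          (hint2.const_mul (t ^ 2))
        have h2 := integral_add (integrable_const (1 : ℝ)) (hint.const_mul t)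
        simp only [Pi.add_apply] at h1
        rw [h1, h2, integral_const_mul, integral_const_mul, h0]
        simp
    _ ≤ 1 + t ^ 2 * v := by gcongr
    _ ≤ Real.exp (t ^ 2 * v) := by linarith [Real.add_one_le_exp (t ^ 2 * v)]

theorem measureReal_sum_ge_le_exp {U : ℕ → Ω → ℝ} (hU : iIndepFun U P)
    (hm : ∀ i, Measurable (U i)) {s : Finset ℕ} {b v t r : ℝ} (ht : 0 ≤ t) (htb : t * b ≤ 1)
    (hb : ∀ i ∈ s, ∀ ω, |U i ω| ≤ b) (h0 : ∀ i ∈ s, ∫ ω, U i ω ∂P = 0)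
    (hv : ∀ i ∈ s, ∫ ω, U i ω ^ 2 ∂P ≤ v) :
    P.real {ω | r ≤ ∑ i ∈ s, U i ω} ≤ Real.exp (-t * r + s.card * (t ^ 2 * v)) := by
  have hS : Measurable (∑ i ∈ s, U i) := by fun_prop
  have hbS : ∀ ω, |∑ i ∈ s, U i ω| ≤ s.card * b := fun ω =>
    (Finset.abs_sum_le_sum_abs _ _).trans <| by
      simpa using Finset.sum_le_card_nsmul s (fun i => |U i ω|) b fun i hi => hb i hi ω
  have hexp : Integrable (fun ω => Real.exp (t * (∑ i ∈ s, U i) ω)) P :=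
    Integrable.of_bound (by fun_prop) (Real.exp (t * (s.card * b)))
      (Eventually.of_forall fun ω => by
        rw [Real.norm_eq_abs, Real.abs_exp, Finset.sum_apply]
        exact Real.exp_le_exp.2
          (mul_le_mul_of_nonneg_left ((le_abs_self _).trans (hbS ω)) ht))
  have h1 := measure_ge_le_exp_mul_mgf (X := ∑ i ∈ s, U i) (μ := P) r ht hexp
  simp only [Finset.sum_apply] at h1
  rw [hU.mgf_sum hm] at h1
  refine h1.trans ?_
  rw [Real.exp_add]
  refine mul_le_mul_of_nonneg_left ?_ (Real.exp_pos _).le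
  calc ∏ i ∈ s, mgf (U i) P t ≤ ∏ _i ∈ s, Real.exp (t ^ 2 * v) :=
        Finset.prod_le_prod (fun i _ => mgf_nonneg) fun i hi =>
          mgf_le_exp_of_centered (hm i) ht htb (hb i hi) (h0 i hi) (hv i hi)
    _ = Real.exp (s.card * (t ^ 2 * v)) := by
        rw [Finset.prod_const, ← Real.exp_nat_mul]

/-- A Bernstein type inequality for independent variables with values in `[0, b]` and small
mean. -/
theorem measureReal_abs_sum_sub_ge_le_exp {Z : ℕ → Ω → ℝ} (hZ : iIndepFun Z P)
    (hm : ∀ i, Measurable (Z i)) {s : Finset ℕ} {b G t r : ℝ} (ht : 0 ≤ t) (htb : t * b ≤ 1)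
    (hpos : ∀ i ∈ s, ∀ ω, 0 ≤ Z i ω) (hb : ∀ i ∈ s, ∀ ω, Z i ω ≤ b)
    (hG : ∀ i ∈ s, ∫ ω, Z i ω ∂P ≤ G) :
    P.real {ω | r ≤ |∑ i ∈ s, (Z i ω - ∫ ω', Z i ω' ∂P)|} ≤
      2 * Real.exp (-t * r + s.card * (t ^ 2 * (b * G))) := by
  have hint : ∀ i ∈ s, Integrable (Z i) P := fun i hi =>
    Integrable.of_bound (hm i).aestronglyMeasurable b (Eventually.of_forall fun ω => by
      rw [Real.norm_eq_abs, abs_of_nonneg (hpos i hi ω)]; exact hb i hi ω)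
  have hmean0 : ∀ i ∈ s, 0 ≤ ∫ ω, Z i ω ∂P := fun i hi => integral_nonneg (hpos i hi)
  have hmeanb : ∀ i ∈ s, ∫ ω, Z i ω ∂P ≤ b := fun i hi => by
    simpa using integral_mono (hint i hi) (integrable_const b) (hb i hi)
  let U : ℕ → Ω → ℝ := fun i ω => Z i ω - ∫ ω', Z i ω' ∂P
  have hUm : ∀ i, Measurable (U i) := fun i => (hm i).sub_const _
  have hU : iIndepFun U P := hZ.comp (fun i z => z - ∫ ω', Z i ω' ∂P) fun i => by fun_prop
  have hUb : ∀ i ∈ s, ∀ ω, |U i ω| ≤ b := fun i hi ω => by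
    rw [abs_le]
    constructor <;> simp only [U] <;> linarith [hpos i hi ω, hb i hi ω, hmean0 i hi, hmeanb i hi]
  have hU0 : ∀ i ∈ s, ∫ ω, U i ω ∂P = 0 := fun i hi => by
    simp [U, integral_sub (hint i hi) (integrable_const _)]
  -- The gain over Hoeffding: since `0 ≤ Z ≤ b`, the variance is at most `b E[Z] ≤ b G`, not `b²`.
  -- With `b` of order `n ^ α`, this is what allows every `α < 1`.
  have hUv : ∀ i ∈ s, ∫ ω, U i ω ^ 2 ∂P ≤ b * G := fun i hi => by
    have hb0 : 0 ≤ b := (hmean0 i hi).trans (hmeanb i hi)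
    have h1 : ∫ ω, U i ω ^ 2 ∂P ≤ ∫ ω, Z i ω ^ 2 ∂P := by
      have h2 := variance_le_expectation_sq (μ := P) (hm i).aestronglyMeasurable
      rw [variance_eq_integral (hm i).aemeasurable] at h2
      simpa [U] using h2
    have h3 : ∫ ω, Z i ω ^ 2 ∂P ≤ ∫ ω, b * Z i ω ∂P := by
      refine integral_mono_of_nonneg (Eventually.of_forall fun ω => sq_nonneg _)
        ((hint i hi).const_mul b) (Eventually.of_forall fun ω => ?_)
      simp only [sq]
      exact mul_le_mul_of_nonneg_right (hb i hi ω) (hpos i hi ω)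
    rw [integral_const_mul] at h3
    exact h1.trans (h3.trans (mul_le_mul_of_nonneg_left (hG i hi) hb0))
  have hpos' := measureReal_sum_ge_le_exp (r := r) hU hUm ht htb hUb hU0 hUv
  have hneg := measureReal_sum_ge_le_exp (U := fun i ω => -U i ω) (r := r)
    (hU.comp (fun _ z => -z) fun _ => measurable_neg) (fun i => (hUm i).neg) ht htb
    (fun i hi ω => by simpa using hUb i hi ω) (fun i hi => by simp [integral_neg, hU0 i hi])
    (fun i hi => by simpa using hUv i hi)
  have hsub : {ω | r ≤ |∑ i ∈ s, (Z i ω - ∫ ω', Z i ω' ∂P)|} ⊆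
      {ω | r ≤ ∑ i ∈ s, U i ω} ∪ {ω | r ≤ ∑ i ∈ s, -U i ω} := by
    intro ω hω
    rw [Set.mem_ofPred_eq, le_abs] at hω
    rcases hω with h | h
    · exact Or.inl h
    · right; simpa [U] using h
  calc _ ≤ P.real ({ω | r ≤ ∑ i ∈ s, U i ω} ∪ {ω | r ≤ ∑ i ∈ s, -U i ω}) :=
        measureReal_mono hsub
    _ ≤ _ := measureReal_union_le _ _
    _ ≤ _ := by linarith

end Chernoff

/-- Used for Borel-Cantelli: `n ^ 3 + 1` is the number of grid points, the other factor the
deviation bound at one point. -/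
theorem summable_poly_mul_exp_neg_rpow {c β : ℝ} (hc : 0 < c) (hβ : 0 < β) :
    Summable fun n : ℕ => ((n : ℝ) ^ 3 + 1) * (2 * Real.exp (-c * (n : ℝ) ^ β)) := by
  have h1 : (fun n : ℕ => Real.exp (-c * (n : ℝ) ^ β)) =O[atTop]
      -- The exponent is chosen so that the product with `n ^ 3` is of order `n ^ (-2)`.
      fun n : ℕ => (((n : ℝ) ^ β) ^ (-5 / β)) :=
    ((isLittleO_exp_neg_mul_rpow_atTop hc (-5 / β)).comp_tendsto
      ((tendsto_rpow_atTop hβ).comp tendsto_natCast_atTop_atTop)).isBigO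
  have h2 : (fun n : ℕ => (n : ℝ) ^ 3 + 1) =O[atTop] fun n : ℕ => (n : ℝ) ^ 3 := by
    refine Asymptotics.IsBigO.of_bound 2 ?_
    filter_upwards [eventually_ge_atTop 1] with n hn
    have : (1 : ℝ) ≤ (n : ℝ) ^ 3 := one_le_pow₀ (by exact_mod_cast hn)
    rw [Real.norm_eq_abs, Real.norm_eq_abs, abs_of_nonneg (by positivity),
      abs_of_nonneg (by positivity)]
    linarith
  refine summable_of_isBigO_nat (g := fun n : ℕ => ((n : ℝ) ^ 2)⁻¹)
    (Real.summable_nat_pow_inv.2 one_lt_two) ?_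
  refine (h2.mul (h1.const_mul_left 2)).congr' EventuallyEq.rfl ?_
  filter_upwards [eventually_ge_atTop 1] with n hn
  have hn0 : (0 : ℝ) < n := by exact_mod_cast hn
  rw [← Real.rpow_mul hn0.le, mul_div_cancel₀ _ hβ.ne', Real.rpow_neg hn0.le]
  rw [show (5 : ℝ) = (5 : ℕ) by norm_num, Real.rpow_natCast]
  field_simp

/-! ### Uniform almost sure closeness of the density estimate to its mean. -/

section Uniform

variable {Ω : Type*} [MeasurableSpace Ω] {P : Measure Ω} [IsProbabilityMeasure P]
  {X : ℕ → Ω → ℝ} {K g : ℝ → ℝ} {α : ℝ}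

theorem measureReal_abs_densityEst_sub_ge_le (hXm : ∀ n, Measurable (X n)) (hX : iIndepFun X P)
    (hlaw : ∀ n, P.map (X n) = designLaw g) (hg : IsDesignDensity g) (hK : IsKernel K)
    (hKm : Measurable K) {B G : ℝ} (hB : 0 < B) (hKB : ∀ u, K u ≤ B) (hG0 : 0 < G)
    (hG : ∀ x, g x ≤ G) (hα : 0 ≤ α) {η : ℝ} (hη : 0 < η) :
    ∃ c > 0, ∀ n : ℕ, 1 ≤ n → ∀ x, P.real {ω | η ≤
      |densityEst K (bandwidth α) (fun i => X i ω) n x -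
        meanEst (designLaw g) K (bandwidth α) n x|} ≤
      2 * Real.exp (-c * (n : ℝ) ^ (1 - α)) := by
  -- The Chernoff parameter will be `κ / (B n ^ α)`: `κ ≤ 1` makes it admissible, and `κ G ≤ η / 2`
  -- lets the quadratic term eat at most half of the linear one.
  set κ : ℝ := min 1 (η / (2 * G)) with hκ
  have hκ0 : 0 < κ := lt_min one_pos (by positivity)
  have hκ1 : κ ≤ 1 := min_le_left _ _
  have hκ2 : κ * G ≤ η / 2 := by
    have : κ ≤ η / (2 * G) := min_le_right _ _
    rw [le_div_iff₀ (by positivity)] at this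
    linarith
  refine ⟨κ * η / (2 * B), by positivity, fun n hn x => ?_⟩
  have hn0 : (0 : ℝ) < n := by exact_mod_cast hn
  have hnα : 0 < (n : ℝ) ^ α := Real.rpow_pos_of_pos hn0 _
  let Z : ℕ → Ω → ℝ := fun i ω => 1 / bandwidth α i * K ((X i ω - x) / bandwidth α i)
  have hZm : ∀ i, Measurable fun y => 1 / bandwidth α i * K ((y - x) / bandwidth α i) :=
    fun i => (hKm.comp (by fun_prop)).const_mul _
  have hmean : ∀ i, ∫ ω, Z i ω ∂P = kernelMean (designLaw g) K (bandwidth α i) x := fun i => by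
    rw [kernelMean, ← hlaw i, integral_map (hXm i).aemeasurable (hZm i).aestronglyMeasurable]
  have key := measureReal_abs_sum_sub_ge_le_exp (P := P) (Z := Z) (s := Finset.Icc 1 n)
    (b := B * (n : ℝ) ^ α) (G := G) (t := κ / (B * (n : ℝ) ^ α)) (r := n * η)
    (hX.comp _ hZm) (fun i => (hZm i).comp (hXm i)) (by positivity)
    (by rw [div_mul_cancel₀ _ (by positivity)]; exact hκ1)
    (fun i hi ω => mul_nonneg (one_div_pos.2 (bandwidth_pos (Finset.mem_Icc.1 hi).1)).le
      (hK.nonneg _))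
    (fun i hi ω => by
      rw [mul_comm B]
      exact mul_le_mul (one_div_bandwidth_le hα (Finset.mem_Icc.1 hi).2) (hKB _) (hK.nonneg _)
        hnα.le)
    (fun i hi => by
      rw [hmean]; exact hg.kernelMean_le hK hG (bandwidth_pos (Finset.mem_Icc.1 hi).1) x)
  have hset : {ω | η ≤ |densityEst K (bandwidth α) (fun i => X i ω) n x -
        meanEst (designLaw g) K (bandwidth α) n x|} =
      {ω | n * η ≤ |∑ i ∈ Finset.Icc 1 n, (Z i ω - ∫ ω', Z i ω' ∂P)|} := by
    ext ω
    simp only [Set.mem_ofPred_eq, densityEst, meanEst, ← mul_sub, ← Finset.sum_sub_distrib, hmean]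
    rw [abs_mul, abs_of_pos (one_div_pos.2 hn0), one_div_mul_eq_div, le_div_iff₀ hn0, mul_comm η]
  rw [hset]
  refine key.trans (mul_le_mul_of_nonneg_left (Real.exp_le_exp.2 ?_) zero_le_two)
  rw [Nat.card_Icc, Nat.add_sub_cancel, Real.rpow_sub hn0, Real.rpow_one]
  have h1 : -(κ / (B * (n : ℝ) ^ α)) * (n * η) +
      n * ((κ / (B * (n : ℝ) ^ α)) ^ 2 * (B * (n : ℝ) ^ α * G)) =
      (n / (n : ℝ) ^ α) * (κ / B) * (κ * G - η) := by field_simp; ring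
  have h2 : -(κ * η / (2 * B)) * (n / (n : ℝ) ^ α) = (n / (n : ℝ) ^ α) * (κ / B) * (-(η / 2)) := by
    field_simp
  rw [h1, h2]
  exact mul_le_mul_of_nonneg_left (by linarith) (by positivity)

/-- The two factors `1 / h_i`, from the normalization and from the rescaled argument, are each
bounded by `n`. This crude rate suffices for the grid. -/
theorem abs_kernel_sub_le {L : NNReal} (hL : LipschitzWith L K) (hα : 0 ≤ α) (hα1 : α ≤ 1)
    {i n : ℕ} (hi : 1 ≤ i) (hin : i ≤ n) (y x x' : ℝ) :
    |1 / bandwidth α i * K ((y - x) / bandwidth α i) -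
      1 / bandwidth α i * K ((y - x') / bandwidth α i)| ≤ L * (n : ℝ) ^ 2 * |x - x'| := by
  have hb : 0 < 1 / bandwidth α i := one_div_pos.2 (bandwidth_pos hi)
  have h1n : (1 : ℝ) ≤ n := by exact_mod_cast hi.trans hin
  have hbn : 1 / bandwidth α i ≤ n := (one_div_bandwidth_le hα hin).trans <| by
    simpa using Real.rpow_le_rpow_of_exponent_le h1n hα1
  have h := hL.dist_le_mul ((y - x) / bandwidth α i) ((y - x') / bandwidth α i)
  have h2 : dist ((y - x) / bandwidth α i) ((y - x') / bandwidth α i) =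
      1 / bandwidth α i * |x - x'| := by
    rw [Real.dist_eq, ← sub_div, abs_div, abs_of_pos (bandwidth_pos hi), abs_sub_comm]
    ring_nf
  rw [h2, Real.dist_eq] at h
  rw [← mul_sub, abs_mul, abs_of_pos hb]
  calc _ ≤ 1 / bandwidth α i * (L * (1 / bandwidth α i * |x - x'|)) := by gcongr
    _ ≤ n * (L * (n * |x - x'|)) := by gcongr
    _ = _ := by ring

theorem abs_average_sub_le {u v : ℕ → ℝ} {n : ℕ} {δ : ℝ} (hδ : 0 ≤ δ)
    (h : ∀ i ∈ Finset.Icc 1 n, |u i - v i| ≤ δ) :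
    |1 / (n : ℝ) * ∑ i ∈ Finset.Icc 1 n, u i - 1 / (n : ℝ) * ∑ i ∈ Finset.Icc 1 n, v i| ≤ δ := by
  rcases Nat.eq_zero_or_pos n with rfl | hn
  · simpa using hδ
  have hn0 : (0 : ℝ) < n := by exact_mod_cast hn
  rw [← mul_sub, ← Finset.sum_sub_distrib, abs_mul, abs_of_pos (one_div_pos.2 hn0),
    one_div_mul_eq_div, div_le_iff₀ hn0]
  refine (Finset.abs_sum_le_sum_abs _ _).trans ((Finset.sum_le_card_nsmul _ _ _ h).trans ?_)
  simp [mul_comm]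

theorem abs_densityEst_sub_le {L : NNReal} (hL : LipschitzWith L K) (hα : 0 ≤ α) (hα1 : α ≤ 1)
    (y : ℕ → ℝ) (n : ℕ) (x x' : ℝ) :
    |densityEst K (bandwidth α) y n x - densityEst K (bandwidth α) y n x'| ≤
      L * (n : ℝ) ^ 2 * |x - x'| :=
  abs_average_sub_le (by positivity) fun i hi =>
    abs_kernel_sub_le hL hα hα1 (Finset.mem_Icc.1 hi).1 (Finset.mem_Icc.1 hi).2 _ _ _

theorem abs_meanEst_sub_le {μ : Measure ℝ} [IsProbabilityMeasure μ] {L : NNReal} (hK : IsKernel K)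
    (hL : LipschitzWith L K) (hα : 0 ≤ α) (hα1 : α ≤ 1) (n : ℕ) (x x' : ℝ) :
    |meanEst μ K (bandwidth α) n x - meanEst μ K (bandwidth α) n x'| ≤
      L * (n : ℝ) ^ 2 * |x - x'| := by
  obtain ⟨B, -, hB⟩ := hK.exists_bound hL.continuous
  have hint : ∀ (h x : ℝ), Integrable (fun y => 1 / h * K ((y - x) / h)) μ := fun h x =>
    (Integrable.of_bound (hL.continuous.comp (by fun_prop)).aestronglyMeasurable B
      (Eventually.of_forall fun y => by
        simpa [abs_of_nonneg (hK.nonneg _)] using hB _)).const_mul _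
  refine abs_average_sub_le (by positivity) fun i hi => ?_
  rw [kernelMean, kernelMean, ← integral_sub (hint _ _) (hint _ _)]
  have := norm_integral_le_of_norm_le_const (μ := μ) (C := L * (n : ℝ) ^ 2 * |x - x'|)
    (f := fun y => 1 / bandwidth α i * K ((y - x) / bandwidth α i) -
      1 / bandwidth α i * K ((y - x') / bandwidth α i)) (Eventually.of_forall fun y =>
    abs_kernel_sub_le hL hα hα1 (Finset.mem_Icc.1 hi).1 (Finset.mem_Icc.1 hi).2 y x x')
  simpa using this

/-- Almost sure uniform closeness of the recursive density estimate to its mean. -/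
theorem ae_eventually_abs_densityEst_sub_meanEst_le (hXm : ∀ n, Measurable (X n))
    (hX : iIndepFun X P) (hlaw : ∀ n, P.map (X n) = designLaw g) (hg : IsDesignDensity g)
    (hK : IsKernel K) {L : NNReal} (hL : LipschitzWith L K) (hα : 0 ≤ α) (hα1 : α < 1)
    {η : ℝ} (hη : 0 < η) :
    ∀ᵐ ω ∂P, ∀ᶠ n in atTop, ∀ x ∈ Set.Icc (-1 / 2 : ℝ) (1 / 2),
      |densityEst K (bandwidth α) (fun i => X i ω) n x -
        meanEst (designLaw g) K (bandwidth α) n x| ≤ η := by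
  have : IsProbabilityMeasure (designLaw g) :=
    hlaw 0 ▸ Measure.isProbabilityMeasure_map (hXm 0).aemeasurable
  obtain ⟨B, hB0, hB⟩ := hK.exists_bound hL.continuous
  obtain ⟨g₀, -, G, hG0, -, hG⟩ := hg.exists_bounds
  obtain ⟨c, hc, hdev⟩ := measureReal_abs_densityEst_sub_ge_le hXm hX hlaw hg hK
    hL.continuous.measurable hB0 hB hG0 hG hα (half_pos hη)
  let D : ℕ → ℝ → Ω → ℝ := fun n x ω => |densityEst K (bandwidth α) (fun i => X i ω) n x -
        meanEst (designLaw g) K (bandwidth α) n x|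
  -- Spacing `n ^ (-3)` against the Lipschitz constant `L n ^ 2` costs `L / n`, once for the
  -- estimate and once for its mean.
  let grid : ℕ → ℕ → ℝ := fun n k => -1 / 2 + k / (n : ℝ) ^ 3
  let A : ℕ → Set Ω := fun n => ⋃ k ∈ Finset.range (n ^ 3 + 1), {ω | η / 2 ≤ D n (grid n k) ω}
  have hA : ∀ n, 1 ≤ n →
      P.real (A n) ≤ ((n : ℝ) ^ 3 + 1) * (2 * Real.exp (-c * (n : ℝ) ^ (1 - α))) := by
    intro n hn
    refine (measureReal_biUnion_finset_le _ _).trans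
      ((Finset.sum_le_card_nsmul _ _ _ fun k _ => hdev n hn (grid n k)).trans ?_)
    simp
  have hsum : ∑' n, P (A (n + 1)) ≠ ⊤ := by
    have hs := (summable_nat_add_iff 1).2 (summable_poly_mul_exp_neg_rpow hc (sub_pos.2 hα1))
    refine ne_top_of_le_ne_top hs.tsum_ofReal_ne_top (ENNReal.tsum_le_tsum fun n => ?_)
    rw [← ofReal_measureReal (measure_ne_top P _)]
    exact ENNReal.ofReal_le_ofReal (hA (n + 1) (by omega))
  filter_upwards [ae_eventually_notMem hsum] with ω hω
  have hω' : ∀ᶠ n in atTop, ω ∉ A n := by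
    rw [← map_add_atTop_eq_nat 1, eventually_map]
    exact hω
  have hsmall : ∀ᶠ n : ℕ in atTop, 2 * (L : ℝ) / n ≤ η / 2 :=
    (tendsto_const_div_atTop_nhds_zero_nat (2 * (L : ℝ))).eventually_le_const (half_pos hη)
  filter_upwards [hω', hsmall, eventually_ge_atTop 1] with n hnA hnL hn x hx
  have hn0 : (0 : ℝ) < n := by exact_mod_cast hn
  set k := ⌊(x + 1 / 2) * (n : ℝ) ^ 3⌋₊ with hk
  have hx0 : 0 ≤ (x + 1 / 2) * (n : ℝ) ^ 3 := mul_nonneg (by linarith [hx.1]) (by positivity)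
  have hk1 : (k : ℝ) ≤ (x + 1 / 2) * (n : ℝ) ^ 3 := Nat.floor_le hx0
  have hk2 : (x + 1 / 2) * (n : ℝ) ^ 3 < k + 1 := Nat.lt_floor_add_one _
  have hkn : k ≤ n ^ 3 := by
    have : (k : ℝ) ≤ (n : ℝ) ^ 3 := hk1.trans
      (by nlinarith [hx.2, show (0 : ℝ) < (n : ℝ) ^ 3 by positivity])
    exact_mod_cast this
  have hdist : |x - grid n k| ≤ 1 / (n : ℝ) ^ 3 := by
    have : x - grid n k = ((x + 1 / 2) * (n : ℝ) ^ 3 - k) / (n : ℝ) ^ 3 := by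
      simp only [grid]; field_simp; ring
    rw [this, abs_div, abs_of_pos (show (0 : ℝ) < (n : ℝ) ^ 3 by positivity)]
    gcongr
    rw [abs_le]; constructor <;> linarith
  have hLn : (L : ℝ) * (n : ℝ) ^ 2 * |x - grid n k| ≤ (L : ℝ) / n := by
    calc (L : ℝ) * (n : ℝ) ^ 2 * |x - grid n k| ≤ L * (n : ℝ) ^ 2 * (1 / (n : ℝ) ^ 3) := by gcongr
      _ = (L : ℝ) / n := by field_simp
  have h1 := (abs_densityEst_sub_le hL hα hα1.le (fun i => X i ω) n x (grid n k)).trans hLn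
  have h2 := (abs_meanEst_sub_le (μ := designLaw g) hK hL hα hα1.le n x (grid n k)).trans hLn
  have h3 : D n (grid n k) ω < η / 2 := by
    simp only [A, Set.mem_iUnion, not_exists, Set.mem_ofPred_eq, not_le] at hnA
    exact hnA k (Finset.mem_range.2 (by omega))
  have h4 : 2 * (L : ℝ) / n = (L : ℝ) / n + (L : ℝ) / n := by ring
  simp only [D] at h3
  rw [abs_le] at *
  rw [abs_lt] at h3
  constructor <;> linarith [h1.1, h1.2, h2.1, h2.2, h3.1, h3.2]

end Uniform

/-! ### Martingale series and conditioning on the past. -/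

section Martingale

variable {Ω : Type*} {mΩ : MeasurableSpace Ω} {P : Measure Ω}

/-- Almost sure convergence of series of martingale differences with summable variances. -/
theorem ae_exists_tendsto_sum_of_condExp_eq_zero [IsProbabilityMeasure P]
    {ℱ : Filtration ℕ mΩ} {D : ℕ → Ω → ℝ}
    (hD : ∀ n, StronglyMeasurable[ℱ (n + 1)] (D n)) (hL2 : ∀ n, MemLp (D n) 2 P)
    (h0 : ∀ n, P[D n | ℱ n] =ᵐ[P] 0) {d : ℕ → ℝ} (hd : Summable d)
    (hDd : ∀ n, ∫ ω, D n ω ^ 2 ∂P ≤ d n) :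
    ∀ᵐ ω ∂P, ∃ L, Tendsto (fun n => ∑ i ∈ Finset.range n, D i ω) atTop (𝓝 L) := by
  let S : ℕ → Ω → ℝ := fun n => ∑ i ∈ Finset.range n, D i
  have hSsucc : ∀ n, S (n + 1) = S n + D n := fun n => Finset.sum_range_succ _ _
  have hSm : ∀ n, StronglyMeasurable[ℱ n] (S n) := fun n =>
    Finset.stronglyMeasurable_sum _ fun i hi =>
      (hD i).mono (ℱ.mono (Finset.mem_range.1 hi))
  have hSL2 : ∀ n, MemLp (S n) 2 P := fun n => memLp_finsetSum' _ fun i _ => hL2 i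
  have hSint : ∀ n, Integrable (S n) P := fun n => (hSL2 n).integrable one_le_two
  have hmart : Martingale S ℱ P := by
    refine martingale_of_condExp_sub_eq_zero_nat hSm hSint fun n => ?_
    rw [hSsucc, add_sub_cancel_left]
    exact h0 n
  -- Orthogonality of increments, so that the second moments of `S` add up and stay bounded by `∑
  -- d`. The resulting uniform L¹ bound allows Doob's convergence theorem.
  have horth : ∀ n, ∫ ω, S n ω * D n ω ∂P = 0 := fun n => by
    have hint : Integrable (S n * D n) P := (hSL2 n).integrable_mul (hL2 n)
    have h1 := condExp_mul_of_stronglyMeasurable_left (hSm n) hint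
      ((hL2 n).integrable one_le_two)
    calc ∫ ω, S n ω * D n ω ∂P = ∫ ω, (P[S n * D n | ℱ n]) ω ∂P :=
          (integral_condExp (ℱ.le n)).symm
      _ = ∫ ω, (0 : ℝ) ∂P := by
          refine integral_congr_ae ?_
          filter_upwards [h1, h0 n] with ω h2 h3
          rw [h2, Pi.mul_apply, h3, Pi.zero_apply, mul_zero]
      _ = 0 := by simp
  have hSq : ∀ n, ∫ ω, S n ω ^ 2 ∂P ≤ ∑ i ∈ Finset.range n, d i := by
    intro n
    induction n with
    | zero => simp [S]
    | succ n ih =>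
      have e : ∀ ω, S (n + 1) ω ^ 2 = S n ω ^ 2 + 2 * (S n ω * D n ω) + D n ω ^ 2 := fun ω => by
        rw [hSsucc, Pi.add_apply]; ring
      have i1 := (hSL2 n).integrable_sq
      have i2 : Integrable (fun ω => 2 * (S n ω * D n ω)) P :=
        ((hSL2 n).integrable_mul (hL2 n)).const_mul 2
      have i3 := (hL2 n).integrable_sq
      have a1 := integral_add i1 i2
      have a2 := integral_add (i1.add i2) i3
      simp only [Pi.add_apply] at a2
      simp_rw [e]
      rw [a2, a1, integral_const_mul, horth, Finset.sum_range_succ]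
      linarith [hDd n]
  have hd0 : ∀ n, 0 ≤ d n := fun n => (integral_nonneg fun ω => sq_nonneg _).trans (hDd n)
  have hbdd : ∀ n, eLpNorm (S n) 1 P ≤ ((1 + ∑' i, d i).toNNReal : ENNReal) := fun n => by
    rw [eLpNorm_one_eq_lintegral_enorm, ← ofReal_integral_norm_eq_lintegral_enorm (hSint n)]
    refine ENNReal.ofReal_le_ofReal ?_
    calc ∫ ω, ‖S n ω‖ ∂P ≤ ∫ ω, (1 + S n ω ^ 2) ∂P := by
          refine integral_mono (hSint n).norm ((integrable_const 1).add (hSL2 n).integrable_sq)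
            fun ω => ?_
          simp only [Real.norm_eq_abs]
          nlinarith [sq_nonneg (|S n ω| - 1), sq_abs (S n ω), abs_nonneg (S n ω)]
      _ = 1 + ∫ ω, S n ω ^ 2 ∂P := by
          rw [integral_add (integrable_const 1) (hSL2 n).integrable_sq]; simp
      _ ≤ 1 + ∑' i, d i := by
          linarith [hSq n, hd.sum_le_tsum (Finset.range n) fun i _ => hd0 i]
  filter_upwards [hmart.submartingale.ae_tendsto_limitProcess hbdd] with ω hω
  exact ⟨_, by simpa [S] using hω⟩

theorem ae_summable_of_summable_integral {u : ℕ → Ω → ℝ} (hu : ∀ n, Integrable (u n) P)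
    (hpos : ∀ n ω, 0 ≤ u n ω) {d : ℕ → ℝ} (hd : Summable d) (hud : ∀ n, ∫ ω, u n ω ∂P ≤ d n) :
    ∀ᵐ ω ∂P, Summable fun n => u n ω := by
  have h1 : ∫⁻ ω, ∑' n, ENNReal.ofReal (u n ω) ∂P ≠ ⊤ := by
    rw [lintegral_tsum fun n => (hu n).aemeasurable.ennreal_ofReal]
    refine ne_top_of_le_ne_top hd.tsum_ofReal_ne_top (ENNReal.tsum_le_tsum fun n => ?_)
    rw [← ofReal_integral_eq_lintegral_ofReal (hu n) (Eventually.of_forall (hpos n))]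
    exact ENNReal.ofReal_le_ofReal (hud n)
  have h2 : AEMeasurable (fun ω => ∑' n, ENNReal.ofReal (u n ω)) P :=
    AEMeasurable.tsum fun n => (hu n).aemeasurable.ennreal_ofReal
  filter_upwards [ae_lt_top' h2 h1] with ω hω
  simpa [ENNReal.toReal_ofReal, hpos] using ENNReal.summable_toReal hω.ne

/-- Independence makes the joint law a product, so by Fubini the integral over an event determined
by `V` can be computed by integrating over `W` first, with `V` frozen. -/
theorem condExp_comap_eq_zero_of_indepFun [IsProbabilityMeasure P] {α β : Type*}
    {mα : MeasurableSpace α} {mβ : MeasurableSpace β} {V : Ω → α} {W : Ω → β}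
    (hV : Measurable V) (hW : Measurable W)
    (hVW : IndepFun V W P) {ψ : α → β → ℝ} (hψ : Measurable (Function.uncurry ψ))
    (hint : Integrable (fun ω => ψ (V ω) (W ω)) P)
    (h0 : ∀ v, ∫ w, ψ v w ∂(P.map W) = 0) :
    P[fun ω => ψ (V ω) (W ω) | mα.comap V] =ᵐ[P] 0 := by
  refine (ae_eq_condExp_of_forall_setIntegral_eq hV.comap_le hint
    (fun s _ _ => integrableOn_zero) ?_ stronglyMeasurable_zero.aestronglyMeasurable).symm
  rintro _ ⟨s, hs, rfl⟩ -
  have hmap : P.map (fun ω => (V ω, W ω)) = (P.map V).prod (P.map W) :=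
    (indepFun_iff_map_prod_eq_prod_map_map hV.aemeasurable hW.aemeasurable).1 hVW
  have hVWm : Measurable fun ω => (V ω, W ω) := hV.prodMk hW
  have hint' : Integrable (Function.uncurry ψ) ((P.map V).prod (P.map W)) := by
    rw [← hmap, integrable_map_measure hψ.aestronglyMeasurable hVWm.aemeasurable]
    exact hint
  have hS : MeasurableSet (s ×ˢ (Set.univ : Set β)) := hs.prod MeasurableSet.univ
  have e1 : ∫ ω in V ⁻¹' s, ψ (V ω) (W ω) ∂P =
      ∫ p in s ×ˢ Set.univ, Function.uncurry ψ p ∂((P.map V).prod (P.map W)) := by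
    rw [← hmap, setIntegral_map hS hψ.aestronglyMeasurable hVWm.aemeasurable]
    congr 2
    ext ω; simp
  rw [e1, setIntegral_prod _ hint'.integrableOn]
  simp [Function.uncurry, h0]

/-- The sequence that agrees with `v` up to time `n` and vanishes afterwards. -/
def stopSeq {β : Type*} [Zero β] (n : ℕ) (v : ℕ → β) : ℕ → β := fun i => if i ≤ n then v i else 0

theorem measurable_stopSeq {β : Type*} [Zero β] [MeasurableSpace β] (n : ℕ) :
    Measurable (stopSeq n : (ℕ → β) → ℕ → β) := by
  refine measurable_pi_lambda _ fun i => ?_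
  unfold stopSeq
  split_ifs <;> fun_prop

theorem stopSeq_stopSeq_of_le {β : Type*} [Zero β] {m n : ℕ} (hmn : m ≤ n) (v : ℕ → β) :
    stopSeq m (stopSeq n v) = stopSeq m v := by
  ext i
  unfold stopSeq
  split_ifs with h1 h2
  · rfl
  · exact absurd (h1.trans hmn) h2
  · rfl

/-- The filtration generated by a sequence of random variables. -/
def pastFiltration {β : Type*} [Zero β] [MeasurableSpace β] (Z : Ω → ℕ → β) (hZ : Measurable Z) :
    Filtration ℕ mΩ where
  seq n := MeasurableSpace.comap (fun ω => stopSeq n (Z ω)) inferInstance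
  mono' m n hmn := by
    have h : (fun ω => stopSeq m (Z ω)) = stopSeq m ∘ fun ω => stopSeq n (Z ω) := by
      ext1 ω; exact (stopSeq_stopSeq_of_le hmn _).symm
    change MeasurableSpace.comap _ _ ≤ MeasurableSpace.comap _ _
    rw [h, ← MeasurableSpace.comap_comp]
    exact MeasurableSpace.comap_mono (measurable_stopSeq m).comap_le
  le' n := ((measurable_stopSeq n).comp hZ).comap_le

/-- Innovation form of the martingale theorem: evaluating `ψ n` at the stopped sequence makes its
first argument depend on the past alone, so centering in the new datum suffices. -/
theorem ae_exists_tendsto_sum_of_indepFun_past [IsProbabilityMeasure P]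
    {β : Type*} [Zero β] [MeasurableSpace β]
    {Z : Ω → ℕ → β} (hZ : Measurable Z)
    (hind : ∀ n, IndepFun (fun ω => stopSeq n (Z ω)) (fun ω => Z ω (n + 1)) P)
    {ψ : ℕ → (ℕ → β) → β → ℝ} (hψ : ∀ n, Measurable (Function.uncurry (ψ n)))
    (hL2 : ∀ n, MemLp (fun ω => ψ n (stopSeq n (Z ω)) (Z ω (n + 1))) 2 P)
    (h0 : ∀ n v, ∫ w, ψ n v w ∂(P.map fun ω => Z ω (n + 1)) = 0)
    {d : ℕ → ℝ} (hd : Summable d)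
    (hψd : ∀ n, ∫ ω, ψ n (stopSeq n (Z ω)) (Z ω (n + 1)) ^ 2 ∂P ≤ d n) :
    ∀ᵐ ω ∂P, ∃ L, Tendsto (fun n => ∑ i ∈ Finset.range n, ψ i (stopSeq i (Z ω)) (Z ω (i + 1)))
      atTop (𝓝 L) := by
  have hcoord : ∀ i, Measurable fun ω => Z ω i := fun i => (measurable_pi_apply i).comp hZ
  refine ae_exists_tendsto_sum_of_condExp_eq_zero (ℱ := pastFiltration Z hZ)
    (D := fun n ω => ψ n (stopSeq n (Z ω)) (Z ω (n + 1))) (fun n => ?_) hL2 (fun n => ?_) hd hψd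
  · have h : (fun ω => ψ n (stopSeq n (Z ω)) (Z ω (n + 1))) =
        (fun v : ℕ → β => Function.uncurry (ψ n) (stopSeq n v, v (n + 1))) ∘
          fun ω => stopSeq (n + 1) (Z ω) := by
      ext1 ω
      simp only [Function.comp_apply, stopSeq_stopSeq_of_le n.le_succ, Function.uncurry]
      simp [stopSeq]
    have hm : Measurable fun v : ℕ → β => Function.uncurry (ψ n) (stopSeq n v, v (n + 1)) :=
      (hψ n).comp ((measurable_stopSeq n).prodMk (measurable_pi_apply _))
    rw [h]
    exact (hm.comp (comap_measurable _)).stronglyMeasurable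
  · exact condExp_comap_eq_zero_of_indepFun ((measurable_stopSeq n).comp hZ) (hcoord _) (hind n)
      (hψ n) ((hL2 n).integrable one_le_two) (h0 n)

end Martingale

/-! ### Independence of the next observation from the past of the algorithm. -/

section Independence

variable {Ω : Type*} {mΩ : MeasurableSpace Ω} {P : Measure Ω}

theorem measurePreserving_prodProdProdComm {α β γ δ : Type*} {mα : MeasurableSpace α}
    {mβ : MeasurableSpace β} {mγ : MeasurableSpace γ} {mδ : MeasurableSpace δ}
    (μa : Measure α) (μb : Measure β) (μc : Measure γ) (μd : Measure δ)
    [SFinite μa] [SFinite μb] [SFinite μc] [SFinite μd] :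
    MeasurePreserving (fun p : (α × β) × γ × δ => ((p.1.1, p.2.1), p.1.2, p.2.2))
      ((μa.prod μb).prod (μc.prod μd)) ((μa.prod μc).prod (μb.prod μd)) := by
  have h1 := measurePreserving_prodAssoc μa μb (μc.prod μd)
  have h2 := (measurePreserving_prodAssoc μb μc μd).symm
  have h3 := (Measure.measurePreserving_swap (μ := μb) (ν := μc)).prod (MeasurePreserving.id μd)
  have h4 := measurePreserving_prodAssoc μc μb μd
  have h5 := (measurePreserving_prodAssoc μa μc (μb.prod μd)).symm
  exact h5.comp (((MeasurePreserving.id μa).prod ((h4.comp h3).comp h2)).comp h1)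

/-- The assumptions make the joint law of the four variables the product of their laws, and a
product may be regrouped. -/
theorem indepFun_prodMk_prodMk_of_indepFun [IsProbabilityMeasure P]
    {α β γ δ : Type*} {mα : MeasurableSpace α}
    {mβ : MeasurableSpace β} {mγ : MeasurableSpace γ} {mδ : MeasurableSpace δ}
    {a : Ω → α} {b : Ω → β} {c : Ω → γ} {d : Ω → δ} (ha : Measurable a) (hb : Measurable b)
    (hc : Measurable c) (hd : Measurable d) (hab : IndepFun a b P) (hcd : IndepFun c d P)
    (h : IndepFun (fun ω => (a ω, b ω)) (fun ω => (c ω, d ω)) P) :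
    IndepFun (fun ω => (a ω, c ω)) (fun ω => (b ω, d ω)) P := by
  have hac : IndepFun a c P := h.comp measurable_fst measurable_fst
  have hbd : IndepFun b d P := h.comp measurable_snd measurable_snd
  rw [indepFun_iff_map_prod_eq_prod_map_map (by fun_prop) (by fun_prop)] at *
  rw [hab, hcd] at h
  rw [hac, hbd, ← (measurePreserving_prodProdProdComm (P.map a) (P.map b) (P.map c)
    (P.map d)).map_eq, ← h, Measure.map_map (by fun_prop) (by fun_prop)]
  rfl

/-- Time `0` is left out of the past: the algorithm reads data from time `1` on, and its initial
value may depend on the observation at time `0`. -/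
theorem indepFun_past_of_iIndepFun {X : ℕ → Ω → ℝ} (hX : iIndepFun X P) (hm : ∀ n, Measurable (X n))
    (n : ℕ) : IndepFun (fun ω (i : ℕ) => if i ∈ Finset.Icc 1 n then X i ω else 0) (X (n + 1)) P := by
  have h := hX.indepFun_finset (Finset.Icc 1 n) {n + 1} (by simp) hm
  have h1 : Measurable fun (v : Finset.Icc 1 n → ℝ) (i : ℕ) =>
      if hi : i ∈ Finset.Icc 1 n then v ⟨i, hi⟩ else 0 := by
    refine measurable_pi_lambda _ fun i => ?_
    split_ifs <;> fun_prop
  have h2 : Measurable fun v : ({n + 1} : Finset ℕ) → ℝ => v ⟨n + 1, by simp⟩ := by fun_prop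
  have := h.comp h1 h2
  convert this using 1
  · ext ω i
    simp only [Function.comp_apply, dite_eq_ite]
  · rfl

/-- The data of the algorithm: the initial value, then the pairs of observation time and noise. -/
def dataSeq (θ₀ : Ω → ℝ) (X ε : ℕ → Ω → ℝ) (ω : Ω) (i : ℕ) : ℝ × ℝ :=
  if i = 0 then (θ₀ ω, 0) else (X i ω, ε i ω)

theorem measurable_dataSeq {θ₀ : Ω → ℝ} {X ε : ℕ → Ω → ℝ} (hθ₀ : Measurable θ₀)
    (hX : ∀ n, Measurable (X n)) (hε : ∀ n, Measurable (ε n)) : Measurable (dataSeq θ₀ X ε) := by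
  refine measurable_pi_lambda _ fun i => ?_
  unfold dataSeq
  split_ifs <;> fun_prop

theorem indepFun_stopSeq_dataSeq [IsProbabilityMeasure P]
    {θ₀ : Ω → ℝ} {X ε : ℕ → Ω → ℝ} (hθ₀ : Measurable θ₀)
    (hXm : ∀ n, Measurable (X n)) (hεm : ∀ n, Measurable (ε n)) (hX : iIndepFun X P)
    (hε : iIndepFun ε P) (hXε : IndepFun (fun ω n => X n ω) (fun ω n => ε n ω) P)
    (hθ : IndepFun θ₀ (fun ω (n : ℕ) => (X (n + 1) ω, ε (n + 1) ω)) P) (n : ℕ) :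
    IndepFun (fun ω => stopSeq n (dataSeq θ₀ X ε ω)) (fun ω => dataSeq θ₀ X ε ω (n + 1)) P := by
  let past : (ℕ → ℝ) → ℕ → ℝ := fun x i => if i ∈ Finset.Icc 1 n then x i else 0
  have hpast : Measurable past := by
    refine measurable_pi_lambda _ fun i => ?_
    simp only [past]
    split_ifs <;> fun_prop
  have hXp : Measurable fun ω => past fun i => X i ω := hpast.comp (measurable_pi_lambda _ hXm)
  have hεp : Measurable fun ω => past fun i => ε i ω := hpast.comp (measurable_pi_lambda _ hεm)
  have hsel : Measurable fun x : ℕ → ℝ => (past x, x (n + 1)) :=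
    hpast.prodMk (measurable_pi_apply _)
  have h1 : IndepFun (fun ω => (past (fun i => X i ω), past fun i => ε i ω))
      (fun ω => (X (n + 1) ω, ε (n + 1) ω)) P :=
    indepFun_prodMk_prodMk_of_indepFun hXp (hXm _) hεp (hεm _) (indepFun_past_of_iIndepFun hX hXm n)
      (indepFun_past_of_iIndepFun hε hεm n) (hXε.comp hsel hsel)
  -- The same past read from the sequence shifted by one, the form in which `hθ` is available.
  let past' : (ℕ → ℝ) → ℕ → ℝ := fun x i => if i ∈ Finset.Icc 1 n then x (i - 1) else 0
  have hpast' : Measurable past' := by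
    refine measurable_pi_lambda _ fun i => ?_
    simp only [past']
    split_ifs <;> fun_prop
  have hsel' : Measurable fun x : ℕ → ℝ × ℝ =>
      ((past' (fun i => (x i).1), past' fun i => (x i).2), x n) := by
    have m1 : Measurable fun (x : ℕ → ℝ × ℝ) (i : ℕ) => (x i).1 := by fun_prop
    have m2 : Measurable fun (x : ℕ → ℝ × ℝ) (i : ℕ) => (x i).2 := by fun_prop
    exact ((hpast'.comp m1).prodMk (hpast'.comp m2)).prodMk (measurable_pi_apply n)
  have h2 : IndepFun (fun ω => ((past (fun i => X i ω), past fun i => ε i ω),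
      (X (n + 1) ω, ε (n + 1) ω))) (fun ω => (θ₀ ω, (0 : ℝ))) P := by
    have m3 : Measurable fun x : ℝ => (x, (0 : ℝ)) := by fun_prop
    have := hθ.symm.comp hsel' m3
    convert this using 1
    · ext1 ω
      have e : ∀ x : ℕ → ℝ, past x = past' fun i => x (i + 1) := fun x => by
        ext i
        simp only [past, past', Finset.mem_Icc]
        split_ifs with hi
        · rw [Nat.sub_add_cancel hi.1]
        · rfl
      simp only [Function.comp_apply, e]
    · rfl
  -- The regrouping lemma again, with a constant as fourth variable, moves the initial value to the
  -- side of the past.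
  have h3 := indepFun_prodMk_prodMk_of_indepFun (hXp.prodMk hεp) ((hXm _).prodMk (hεm _)) hθ₀
    (measurable_const (a := (0 : ℝ))) h1 (indepFun_const_right _ _) h2
  have h4 : Measurable fun (p : ((ℕ → ℝ) × (ℕ → ℝ)) × ℝ) (i : ℕ) =>
      if i = 0 then (p.2, (0 : ℝ)) else (p.1.1 i, p.1.2 i) := by
    refine measurable_pi_lambda _ fun i => ?_
    split_ifs <;> fun_prop
  have h5 := h3.comp h4 measurable_fst
  convert h5 using 1
  · ext1 ω
    ext1 i
    simp only [Function.comp_apply, stopSeq, dataSeq, past, Finset.mem_Icc]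
    rcases Nat.eq_zero_or_pos i with rfl | hi
    · simp
    · by_cases hin : i ≤ n
      · simp [hi.ne', hin, Nat.succ_le_of_lt hi]
      · simp only [hi.ne', hin, and_false, if_false]
        rfl
  · ext1 ω
    simp [dataSeq]

end Independence

/-! ### The deterministic convergence argument along one path. -/

/-- Pathwise convergence of the projected Robbins-Monro recursion. -/
theorem tendsto_of_projected_recursion {t T Φ γ η : ℕ → ℝ} {s a θ L : ℝ} (hs : s ^ 2 = 1)
    (hsa : 0 < s * a) (hθ : |θ| < 1 / 4) (ht : ∀ n, t n ∈ Set.Icc (-1 / 4 : ℝ) (1 / 4))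
    (hrec : ∀ᶠ n in atTop, t (n + 1) = projC (t n + s * γ n * T n))
    (hγ : ∀ n, 0 ≤ γ n) (hγ0 : Tendsto γ atTop (𝓝 0))
    (hγs : Tendsto (fun n => ∑ i ∈ Finset.range n, γ i) atTop atTop)
    (hΦ : ∀ᶠ n in atTop, |Φ n - a * Real.sin (2 * Real.pi * (θ - t n))| ≤ η n)
    (hη : Tendsto η atTop (𝓝 0))
    (hD : Tendsto (fun n => ∑ i ∈ Finset.range n, 2 * (t i - θ) * (s * γ i * (T i - Φ i))) atTop
      (𝓝 L))
    (hsq : Summable fun n => (γ n * T n) ^ 2) :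
    Tendsto t atTop (𝓝 θ) ∧
      ∀ᶠ n in atTop, t n + s * γ n * T n ∈ Set.Icc (-1 / 4 : ℝ) (1 / 4) := by
  obtain ⟨hθ1, hθ2⟩ := abs_lt.1 hθ
  have hθC : projC θ = θ := projC_of_mem ⟨by linarith, by linarith⟩
  -- The assumption `|θ| < 1/4` enters here: it gives `ρ < 1/2`, hence `cos (πρ) > 0` and a true
  -- contraction.
  set ρ : ℝ := 1 / 4 + |θ| with hρ
  have hu : ∀ n, |θ - t n| ≤ ρ := fun n => by
    have h1 : |t n| ≤ 1 / 4 := abs_le.2 ⟨by linarith [(ht n).1], (ht n).2⟩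
    linarith [abs_sub θ (t n)]
  have hcos : 0 < Real.cos (Real.pi * ρ) :=
    Real.cos_pos_of_mem_Ioo ⟨by nlinarith [Real.pi_pos, abs_nonneg θ],
      by nlinarith [Real.pi_pos]⟩
  have hs1 : |s| = 1 := by
    rw [← sq_eq_sq₀ (abs_nonneg _) zero_le_one, sq_abs, hs, one_pow]
  have hV : Tendsto (fun n => (t n - θ) ^ 2) atTop (𝓝 0) := by
    refine tendsto_zero_of_recursive_le (c := 8 * (s * a) * Real.cos (Real.pi * ρ)) (η := η)
      (ξ := fun n => 2 * (t n - θ) * (s * γ n * (T n - Φ n)) + (γ n * T n) ^ 2)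
      (L := L + ∑' n, (γ n * T n) ^ 2) (by positivity) (fun n => sq_nonneg _) hγ hγ0 hγs hη ?_ ?_
    · simp only [Finset.sum_add_distrib]
      exact hD.add hsq.hasSum.tendsto_sum_nat
    · filter_upwards [hrec, hΦ] with n h1 h2
      have h3 : (t (n + 1) - θ) ^ 2 ≤ (t n + s * γ n * T n - θ) ^ 2 := by
        rw [h1]
        refine sq_le_sq.2 ?_
        conv_lhs => rw [← hθC]
        exact abs_projC_sub_projC_le _ _
      have h4 : (t n + s * γ n * T n - θ) ^ 2 = (t n - θ) ^ 2 +
          2 * (t n - θ) * (s * γ n * (T n - Φ n)) + (γ n * T n) ^ 2 +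
          γ n * (2 * (t n - θ) * s * Φ n) := by
        linear_combination (γ n * T n) ^ 2 * hs
      have h5 := mul_sin_two_pi_mul_ge (show ρ ≤ 1 / 2 by linarith) (hu n)
      set r := Φ n - a * Real.sin (2 * Real.pi * (θ - t n)) with hr
      have h6 : 2 * (t n - θ) * s * Φ n =
          -2 * (s * a) * ((θ - t n) * Real.sin (2 * Real.pi * (θ - t n))) +
            2 * (t n - θ) * s * r := by rw [hr]; ring
      have h7 : 2 * (t n - θ) * s * r ≤ η n := by
        have h8 : |2 * (t n - θ) * s| ≤ 1 := by
          rw [abs_mul, hs1, mul_one, abs_mul, abs_two, abs_sub_comm]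
          linarith [hu n]
        calc 2 * (t n - θ) * s * r ≤ |2 * (t n - θ) * s * r| := le_abs_self _
          _ = |2 * (t n - θ) * s| * |r| := abs_mul _ _
          _ ≤ 1 * |r| := mul_le_mul_of_nonneg_right h8 (abs_nonneg _)
          _ ≤ η n := by rw [one_mul]; exact h2
      have h8 : 2 * (t n - θ) * s * Φ n ≤
          -(8 * (s * a) * Real.cos (Real.pi * ρ)) * (t n - θ) ^ 2 + η n := by
        rw [h6]
        have := mul_le_mul_of_nonneg_left h5 hsa.le
        nlinarith
      have h9 := mul_le_mul_of_nonneg_left h8 (hγ n)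
      rw [h4] at h3
      nlinarith
  have hlim : Tendsto t atTop (𝓝 θ) := by
    have h1 : Tendsto (fun n => |t n - θ|) atTop (𝓝 0) := by
      simpa [Real.sqrt_sq_eq_abs] using hV.sqrt
    rw [tendsto_iff_dist_tendsto_zero]
    exact h1
  refine ⟨hlim, ?_⟩
  have hγT : Tendsto (fun n => γ n * T n) atTop (𝓝 0) := by
    have h1 : Tendsto (fun n => |γ n * T n|) atTop (𝓝 0) := by
      simpa [Real.sqrt_sq_eq_abs] using hsq.tendsto_atTop_zero.sqrt
    exact (tendsto_zero_iff_abs_tendsto_zero _).2 h1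
  have hpre : Tendsto (fun n => t n + s * γ n * T n) atTop (𝓝 θ) := by
    simpa [mul_assoc] using hlim.add (hγT.const_mul s)
  exact hpre.eventually_mem (Icc_mem_nhds (by linarith) (by linarith))

/-! ### Adaptedness and measurability of the algorithm. -/

theorem estimator_mem {K : ℝ → ℝ} {h γ : ℕ → ℝ} {s t₀ : ℝ} {x y : ℕ → ℝ}
    (ht₀ : t₀ ∈ Set.Icc (-1 / 4 : ℝ) (1 / 4)) (n : ℕ) :
    estimator K h γ s t₀ x y n ∈ Set.Icc (-1 / 4 : ℝ) (1 / 4) := by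
  cases n with
  | zero => exact ht₀
  | succ n => exact projC_mem _

theorem densityEst_congr {K : ℝ → ℝ} {h x x' : ℕ → ℝ} {n : ℕ} (hx : ∀ i ∈ Finset.Icc 1 n, x i = x' i)
    (t : ℝ) : densityEst K h x n t = densityEst K h x' n t := by
  unfold densityEst
  rw [Finset.sum_congr rfl fun i hi => by rw [hx i hi]]

theorem estimator_congr {K : ℝ → ℝ} {h γ : ℕ → ℝ} {s t₀ : ℝ} {x y x' y' : ℕ → ℝ} {n : ℕ}
    (hx : ∀ i ∈ Finset.Icc 1 n, x i = x' i) (hy : ∀ i ∈ Finset.Icc 1 n, y i = y' i) :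
    estimator K h γ s t₀ x y n = estimator K h γ s t₀ x' y' n := by
  induction n with
  | zero => rfl
  | succ n ih =>
    have hmono : ∀ i ∈ Finset.Icc 1 n, i ∈ Finset.Icc 1 (n + 1) := fun i hi =>
      Finset.Icc_subset_Icc_right n.le_succ hi
    have hlast : n + 1 ∈ Finset.Icc 1 (n + 1) := by simp
    simp only [estimator, preUpdate, increment]
    rw [ih (fun i hi => hx i (hmono i hi)) (fun i hi => hy i (hmono i hi)),
      densityEst_congr (fun i hi => hx i (hmono i hi)), hx _ hlast, hy _ hlast]

theorem measurable_densityEst {A : Type*} [MeasurableSpace A] {K : ℝ → ℝ} (hK : Measurable K)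
    (h : ℕ → ℝ) (n : ℕ) {x : A → ℕ → ℝ} {t : A → ℝ} (hx : Measurable x) (ht : Measurable t) :
    Measurable fun a => densityEst K h (x a) n (t a) := by
  unfold densityEst
  have hxi : ∀ i, Measurable fun a => x a i := fun i => (measurable_pi_apply i).comp hx
  exact (Finset.measurable_sum _ fun i _ =>
    (hK.comp (((hxi i).sub ht).div_const _)).const_mul _).const_mul _

theorem measurable_estimator {A : Type*} [MeasurableSpace A] {K : ℝ → ℝ} (hK : Measurable K)
    (h γ : ℕ → ℝ) (s : ℝ) {t₀ : A → ℝ} {x y : A → ℕ → ℝ} (ht₀ : Measurable t₀)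
    (hx : Measurable x) (hy : Measurable y) (n : ℕ) :
    Measurable fun a => estimator K h γ s (t₀ a) (x a) (y a) n := by
  have hxi : ∀ i, Measurable fun a => x a i := fun i => (measurable_pi_apply i).comp hx
  have hyi : ∀ i, Measurable fun a => y a i := fun i => (measurable_pi_apply i).comp hy
  induction n with
  | zero => exact ht₀
  | succ n ih =>
    simp only [estimator, preUpdate, increment]
    refine continuous_projC.measurable.comp (ih.add ((Measurable.mul ?_ (hyi _)).const_mul _))
    exact (Real.measurable_sin.comp (((hxi _).sub ih).const_mul _)).div
      (measurable_densityEst hK h n hx (hxi _))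

/-! ### The truncated increment, its mean and the bias from density estimation. -/

/-- The increment of the algorithm at the current value `t` for a new pair `w` of observation time
and noise, with the density estimate truncated from below at `c₀`. -/
noncomputable def truncIncrement (K f : ℝ → ℝ) (θ c₀ : ℝ) (h x : ℕ → ℝ) (n : ℕ) (t : ℝ)
    (w : ℝ × ℝ) : ℝ :=
  Real.sin (2 * Real.pi * (w.1 - t)) / max (densityEst K h x n w.1) c₀ * (f (w.1 - θ) + w.2)

section TruncIncrement

variable {K f g : ℝ → ℝ} {θ c₀ M : ℝ}

theorem increment_eq_truncIncrement {h x ε y : ℕ → ℝ} {n : ℕ} {t : ℝ}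
    (hy : y (n + 1) = f (x (n + 1) - θ) + ε (n + 1))
    (hc : c₀ ≤ densityEst K h x n (x (n + 1))) :
    increment K h x y n t = truncIncrement K f θ c₀ h x n t (x (n + 1), ε (n + 1)) := by
  rw [increment, truncIncrement, hy, max_eq_left hc]

theorem measurable_truncIncrement {A : Type*} [MeasurableSpace A] (hK : Measurable K)
    (hf : Measurable f) (h : ℕ → ℝ) (n : ℕ) {x : A → ℕ → ℝ} {t : A → ℝ} {w : A → ℝ × ℝ}
    (hx : Measurable x) (ht : Measurable t) (hw : Measurable w) :
    Measurable fun a => truncIncrement K f θ c₀ h (x a) n (t a) (w a) := by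
  unfold truncIncrement
  exact ((Real.measurable_sin.comp ((hw.fst.sub ht).const_mul _)).div
    ((measurable_densityEst hK h n hx hw.fst).max measurable_const)).mul
      ((hf.comp (hw.fst.sub_const _)).add hw.snd)

theorem abs_sin_div_max_le (hc₀ : 0 < c₀) (u d : ℝ) : |Real.sin u / max d c₀| ≤ 1 / c₀ := by
  rw [abs_div, abs_of_pos (lt_max_of_lt_right hc₀)]
  exact div_le_div₀ zero_le_one (Real.abs_sin_le_one _) hc₀ (le_max_right _ _)

theorem abs_truncIncrement_le (hc₀ : 0 < c₀) (hM : ∀ x, |f x| ≤ M) (h x : ℕ → ℝ) (n : ℕ) (t : ℝ)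
    (w : ℝ × ℝ) : |truncIncrement K f θ c₀ h x n t w| ≤ 1 / c₀ * (M + |w.2|) := by
  rw [truncIncrement, abs_mul]
  exact mul_le_mul (abs_sin_div_max_le hc₀ _ _)
    ((abs_add_le _ _).trans (by linarith [hM (w.1 - θ)])) (abs_nonneg _) (by positivity)

/-- Periodicity allows the shift of the variable by `θ` over a full period; then expand the sine of
the sum. The sine part pairs an odd function with the even `f` and vanishes. -/
theorem integral_sin_mul_shift (hf : IsShape f) (θ t : ℝ) :
    ∫ x in Set.Icc (-1 / 2 : ℝ) (1 / 2), Real.sin (2 * Real.pi * (x - t)) * f (x - θ) =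
      firstFourier f * Real.sin (2 * Real.pi * (θ - t)) := by
  obtain ⟨M, hM⟩ := hf.bounded
  have hper : Function.Periodic (fun x => Real.sin (2 * Real.pi * (x - t)) * f (x - θ)) 1 := by
    intro x
    have h1 : 2 * Real.pi * (x + 1 - t) = 2 * Real.pi * (x - t) + 2 * Real.pi := by ring
    have h2 : x + 1 - θ = x - θ + 1 := by ring
    simp only [h1, h2, Real.sin_add_two_pi, hf.periodic (x - θ)]
  have hint : ∀ φ : ℝ → ℝ, Continuous φ → (∀ x, |φ x| ≤ 1) →
      IntervalIntegrable (fun u => φ u * f u) volume (-1 / 2) (1 / 2) := by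
    intro φ hφ hφ1
    rw [intervalIntegrable_iff_integrableOn_Icc_of_le (by norm_num)]
    refine Integrable.of_bound (hφ.measurable.mul hf.measurable).aestronglyMeasurable M
      (Eventually.of_forall fun u => ?_)
    rw [Real.norm_eq_abs, abs_mul]
    calc |φ u| * |f u| ≤ 1 * |f u| := mul_le_mul_of_nonneg_right (hφ1 u) (abs_nonneg _)
      _ ≤ M := by rw [one_mul]; exact hM u
  have hodd : ∫ u in (-1 / 2 : ℝ)..(1 / 2), Real.sin (2 * Real.pi * u) * f u = 0 := by
    have h1 := intervalIntegral.integral_comp_neg (a := (-1 / 2 : ℝ)) (b := 1 / 2)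
      fun u => Real.sin (2 * Real.pi * u) * f u
    simp only [mul_neg, Real.sin_neg, hf.even, neg_mul, intervalIntegral.integral_neg] at h1
    rw [show -(-1 / 2 : ℝ) = 1 / 2 by norm_num, show -(1 / 2 : ℝ) = -1 / 2 by norm_num] at h1
    linarith
  rw [integral_Icc_eq_integral_Ioc, ← intervalIntegral.integral_of_le (by norm_num)]
  have h1 := hper.intervalIntegral_add_eq (-1 / 2) (-1 / 2 + θ)
  rw [show (-1 / 2 : ℝ) + 1 = 1 / 2 by norm_num,
    show (-1 / 2 : ℝ) + θ + 1 = 1 / 2 + θ by ring] at h1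
  rw [h1, ← intervalIntegral.integral_comp_add_right
    (fun x => Real.sin (2 * Real.pi * (x - t)) * f (x - θ)) θ]
  have h2 : ∀ u, Real.sin (2 * Real.pi * (u + θ - t)) * f (u + θ - θ) =
      Real.cos (2 * Real.pi * (θ - t)) * (Real.sin (2 * Real.pi * u) * f u) +
      Real.sin (2 * Real.pi * (θ - t)) * (Real.cos (2 * Real.pi * u) * f u) := fun u => by
    rw [show 2 * Real.pi * (u + θ - t) = 2 * Real.pi * u + 2 * Real.pi * (θ - t) by ring,
      Real.sin_add, add_sub_cancel_right]
    ring
  simp_rw [h2]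
  rw [intervalIntegral.integral_add
      ((hint _ (by fun_prop) fun _ => Real.abs_sin_le_one _).const_mul _)
      ((hint _ (by fun_prop) fun _ => Real.abs_cos_le_one _).const_mul _),
    intervalIntegral.integral_const_mul, intervalIntegral.integral_const_mul, hodd, firstFourier]
  ring

theorem integrable_truncIncrement {μ ν : Measure ℝ} [IsProbabilityMeasure μ]
    [IsProbabilityMeasure ν] (hc₀ : 0 < c₀) (hK : Measurable K) (hf : Measurable f)
    (hM : ∀ x, |f x| ≤ M) (hν : Integrable (fun e => e) ν) (h x : ℕ → ℝ) (n : ℕ) (t : ℝ) :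
    Integrable (truncIncrement K f θ c₀ h x n t) (μ.prod ν) := by
  have hb : Integrable (fun w : ℝ × ℝ => 1 / c₀ * (M + |w.2|)) (μ.prod ν) :=
    ((integrable_const M).add (hν.abs.comp_snd μ)).const_mul _
  refine hb.mono' (measurable_truncIncrement hK hf h n measurable_const measurable_const
    measurable_id).aestronglyMeasurable (Eventually.of_forall fun w => ?_)
  exact abs_truncIncrement_le hc₀ hM h x n t w

/-- The mean error of the truncated density estimate, as a ratio. -/
noncomputable def ratioError (K g : ℝ → ℝ) (c₀ : ℝ) (h x : ℕ → ℝ) (n : ℕ) : ℝ :=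
  ∫ y in Set.Icc (-1 / 2 : ℝ) (1 / 2), |g y / max (densityEst K h x n y) c₀ - 1|

theorem abs_ratio_sub_one_le {G : ℝ} (hg : IsDesignDensity g) (hG : ∀ x, g x ≤ G) (hc₀ : 0 < c₀)
    (y d : ℝ) : |(|g y / max d c₀ - 1|)| ≤ G / c₀ + 1 := by
  have h1 : 0 ≤ g y / max d c₀ := div_nonneg (hg.nonneg y) (hc₀.le.trans (le_max_right _ _))
  have h2 : g y / max d c₀ ≤ G / c₀ :=
    div_le_div₀ ((hg.nonneg y).trans (hG y)) (hG y) hc₀ (le_max_right _ _)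
  rw [abs_abs, abs_le]
  constructor <;> linarith

theorem measurable_ratio (hg : IsDesignDensity g) (hK : Measurable K) (c₀ : ℝ) (h x : ℕ → ℝ)
    (n : ℕ) : Measurable fun y => g y / max (densityEst K h x n y) c₀ :=
  hg.measurable.div ((measurable_densityEst hK h n measurable_const measurable_id).max
    measurable_const)

/-- The centered noise integrates out, and the design density turns `1 / max ĝ c₀` into a ratio.
Replacing this ratio by `1` gives the ideal drift, at a cost uniform in `t`. -/
theorem abs_integral_truncIncrement_sub_le {ν : Measure ℝ} [IsProbabilityMeasure (designLaw g)]
    [IsProbabilityMeasure ν] (hg : IsDesignDensity g) (hf : IsShape f) (hc₀ : 0 < c₀)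
    (hK : Measurable K) (hM : ∀ x, |f x| ≤ M) (hν : Integrable (fun e => e) ν)
    (hν0 : ∫ e, e ∂ν = 0) (h x : ℕ → ℝ) (n : ℕ) (t : ℝ) :
    |∫ w, truncIncrement K f θ c₀ h x n t w ∂((designLaw g).prod ν) -
      firstFourier f * Real.sin (2 * Real.pi * (θ - t))| ≤ M * ratioError K g c₀ h x n := by
  obtain ⟨-, -, G, -, -, hG⟩ := hg.exists_bounds
  have hratio := measurable_ratio hg hK c₀ h x n
  have e1 : ∀ y, ∫ e, truncIncrement K f θ c₀ h x n t (y, e) ∂ν =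
      Real.sin (2 * Real.pi * (y - t)) / max (densityEst K h x n y) c₀ * f (y - θ) := fun y => by
    simp only [truncIncrement]
    rw [integral_const_mul, integral_add (integrable_const _) hν, hν0]
    simp
  rw [integral_prod _ (integrable_truncIncrement hc₀ hK hf.measurable hM hν h x n t)]
  simp_rw [e1]
  rw [hg.integral_designLaw_eq_setIntegral, ← integral_sin_mul_shift hf θ t]
  have hsf : Measurable fun y => Real.sin (2 * Real.pi * (y - t)) * f (y - θ) :=
    (by fun_prop : Measurable fun y : ℝ => Real.sin (2 * Real.pi * (y - t))).mul
      (hf.measurable.comp (measurable_id.sub_const θ))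
  have hsfM : ∀ y, |Real.sin (2 * Real.pi * (y - t)) * f (y - θ)| ≤ M := fun y => by
    rw [abs_mul]
    calc _ ≤ 1 * |f (y - θ)| :=
          mul_le_mul_of_nonneg_right (Real.abs_sin_le_one _) (abs_nonneg _)
      _ ≤ M := by rw [one_mul]; exact hM _
  have i0 : IntegrableOn (fun y => Real.sin (2 * Real.pi * (y - t)) * f (y - θ))
      (Set.Icc (-1 / 2 : ℝ) (1 / 2)) := Integrable.of_bound hsf.aestronglyMeasurable M
    (Eventually.of_forall hsfM)
  have iR : IntegrableOn (fun y => |g y / max (densityEst K h x n y) c₀ - 1|)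
      (Set.Icc (-1 / 2 : ℝ) (1 / 2)) :=
    Integrable.of_bound (hratio.sub_const 1).abs.aestronglyMeasurable (G / c₀ + 1)
      (Eventually.of_forall fun y => abs_ratio_sub_one_le hg hG hc₀ y _)
  have hb : ∀ y, |(g y / max (densityEst K h x n y) c₀ - 1) *
      (Real.sin (2 * Real.pi * (y - t)) * f (y - θ))| ≤
      M * |g y / max (densityEst K h x n y) c₀ - 1| := fun y => by
    rw [abs_mul, mul_comm M]
    exact mul_le_mul_of_nonneg_left (hsfM y) (abs_nonneg _)
  have i1 : IntegrableOn (fun y => (g y / max (densityEst K h x n y) c₀ - 1) *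
      (Real.sin (2 * Real.pi * (y - t)) * f (y - θ))) (Set.Icc (-1 / 2 : ℝ) (1 / 2)) :=
    (iR.const_mul M).mono' ((hratio.sub_const 1).mul hsf).aestronglyMeasurable
      (Eventually.of_forall hb)
  have e2 : ∫ y in Set.Icc (-1 / 2 : ℝ) (1 / 2), g y * (Real.sin (2 * Real.pi * (y - t)) /
        max (densityEst K h x n y) c₀ * f (y - θ)) =
      ∫ y in Set.Icc (-1 / 2 : ℝ) (1 / 2), ((g y / max (densityEst K h x n y) c₀ - 1) *
        (Real.sin (2 * Real.pi * (y - t)) * f (y - θ)) +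
        Real.sin (2 * Real.pi * (y - t)) * f (y - θ)) := by
    congr 1
    ext1 y
    ring
  rw [e2, integral_add i1 i0, add_sub_cancel_right, ratioError, ← integral_const_mul]
  exact norm_integral_le_of_norm_le (iR.const_mul M)
    (Eventually.of_forall fun y => (Real.norm_eq_abs _).trans_le (hb y))

/-- Dominated convergence, the truncation providing the bound. The end points, where consistency
fails, are negligible, and `c₀ ≤ g` makes the truncation harmless in the limit. -/
theorem tendsto_ratioError (hg : IsDesignDensity g) (hK : Measurable K) (hc₀ : 0 < c₀)
    (hc₀g : ∀ x ∈ Set.Icc (-1 / 2 : ℝ) (1 / 2), c₀ ≤ g x) {h x : ℕ → ℝ}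
    (hlim : ∀ y ∈ Set.Ioo (-1 / 2 : ℝ) (1 / 2),
      Tendsto (fun n => densityEst K h x n y) atTop (𝓝 (g y))) :
    Tendsto (ratioError K g c₀ h x) atTop (𝓝 0) := by
  obtain ⟨-, -, G, -, -, hG⟩ := hg.exists_bounds
  unfold ratioError
  simp only [integral_Icc_eq_integral_Ioo]
  rw [show (0 : ℝ) = ∫ y in Set.Ioo (-1 / 2 : ℝ) (1 / 2), (0 : ℝ) by simp]
  refine tendsto_integral_of_dominated_convergence (fun _ => G / c₀ + 1)
    (fun n => ((measurable_ratio hg hK c₀ h x n).sub_const 1).abs.aestronglyMeasurable)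
    (integrable_const _)
    (fun n => Eventually.of_forall fun y => abs_ratio_sub_one_le hg hG hc₀ y _)
    ((ae_restrict_iff' measurableSet_Ioo).2 (Eventually.of_forall fun y hy => ?_))
  have hy' := Set.Ioo_subset_Icc_self hy
  have h1 : Tendsto (fun n => max (densityEst K h x n y) c₀) atTop (𝓝 (g y)) := by
    have := (hlim y hy).max (tendsto_const_nhds (x := c₀))
    rwa [max_eq_left (hc₀g y hy')] at this
  have h2 := (((tendsto_const_nhds (x := g y)).div h1 (hg.pos y hy').ne').sub_const 1).abs
  simpa [div_self (hg.pos y hy').ne'] using h2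

end TruncIncrement

/-! ### Consistency of the density estimate and moment bounds. -/

section Limits

variable {Ω : Type*} [MeasurableSpace Ω] {P : Measure Ω} {X : ℕ → Ω → ℝ} {K g : ℝ → ℝ} {α : ℝ}

/-- Strong consistency of the recursive density estimate inside the support, together with a
uniform lower bound on the whole support, where boundary effects occur. -/
theorem ae_tendsto_densityEst [IsProbabilityMeasure P] (hXm : ∀ n, Measurable (X n))
    (hX : iIndepFun X P) (hlaw : ∀ n, P.map (X n) = designLaw g) (hg : IsDesignDensity g)
    (hK : IsKernel K) {L : NNReal} (hL : LipschitzWith L K) (hα : 0 < α) (hα1 : α < 1)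
    {g₀ : ℝ} (hg₀pos : 0 < g₀) (hg₀ : ∀ x ∈ Set.Icc (-1 / 2 : ℝ) (1 / 2), g₀ ≤ g x) :
    ∀ᵐ ω ∂P, (∀ y ∈ Set.Ioo (-1 / 2 : ℝ) (1 / 2),
      Tendsto (fun n => densityEst K (bandwidth α) (fun i => X i ω) n y) atTop (𝓝 (g y))) ∧
      ∀ᶠ n in atTop, ∀ x ∈ Set.Icc (-1 / 2 : ℝ) (1 / 2),
        g₀ / 8 ≤ densityEst K (bandwidth α) (fun i => X i ω) n x := by
  have hunif := ae_all_iff.2 fun k : ℕ => ae_eventually_abs_densityEst_sub_meanEst_le hXm hX hlaw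
    hg hK hL hα.le hα1 (Nat.one_div_pos_of_nat (n := k) (α := ℝ))
  filter_upwards [hunif] with ω hω
  refine ⟨fun y hy => ?_, ?_⟩
  · have h0 : Tendsto (fun n => densityEst K (bandwidth α) (fun i => X i ω) n y -
        meanEst (designLaw g) K (bandwidth α) n y) atTop (𝓝 0) := by
      rw [Metric.tendsto_atTop]
      intro η hη
      obtain ⟨k, hk⟩ := exists_nat_one_div_lt hη
      obtain ⟨N, hN⟩ := eventually_atTop.1 (hω k)
      refine ⟨N, fun n hn => ?_⟩
      rw [Real.dist_eq, sub_zero]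
      exact (hN n hn y (Set.Ioo_subset_Icc_self hy)).trans_lt hk
    simpa using h0.add (hg.tendsto_meanEst hK hα hy)
  · obtain ⟨k, hk⟩ := exists_nat_one_div_lt (show 0 < g₀ / 8 by positivity)
    filter_upwards [hω k, hg.eventually_meanEst_ge hK hα hg₀pos hg₀] with n h1 h2 x hx
    linarith [(abs_le.1 (h1 x hx)).1, h2 x hx]

theorem memLp_two_and_integral_sq_le {u b : Ω → ℝ} {c : ℝ} (hu : Measurable u) (hb : MemLp b 2 P)
    (hub : ∀ ω, |u ω| ≤ c * b ω) :
    MemLp u 2 P ∧ ∫ ω, u ω ^ 2 ∂P ≤ c ^ 2 * ∫ ω, b ω ^ 2 ∂P := by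
  have hcb : MemLp (fun ω => c * b ω) 2 P := hb.const_mul c
  refine ⟨hcb.mono' hu.aestronglyMeasurable (Eventually.of_forall hub), ?_⟩
  rw [← integral_const_mul]
  refine integral_mono_of_nonneg (Eventually.of_forall fun ω => sq_nonneg _)
    (hb.integrable_sq.const_mul _) (Eventually.of_forall fun ω => ?_)
  simp only
  rw [← mul_pow, ← sq_abs (u ω)]
  exact pow_le_pow_left₀ (abs_nonneg _) (hub ω) 2

theorem map_dataSeq {θ₀ : Ω → ℝ} {ε : ℕ → Ω → ℝ} [IsProbabilityMeasure P]
    (hXm : ∀ n, Measurable (X n)) (hεm : ∀ n, Measurable (ε n))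
    (hlaw : ∀ n, P.map (X n) = designLaw g) (hεident : ∀ n, IdentDistrib (ε n) (ε 0) P P)
    (hXε : IndepFun (fun ω n => X n ω) (fun ω n => ε n ω) P) (n : ℕ) :
    P.map (fun ω => dataSeq θ₀ X ε ω (n + 1)) = (designLaw g).prod (P.map (ε 0)) := by
  have h : IndepFun (X (n + 1)) (ε (n + 1)) P :=
    hXε.comp (measurable_pi_apply (n + 1)) (measurable_pi_apply (n + 1))
  rw [indepFun_iff_map_prod_eq_prod_map_map (hXm _).aemeasurable (hεm _).aemeasurable,
    hlaw, (hεident (n + 1)).map_eq] at h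
  simpa [dataSeq] using h

theorem sign_mul_pos_and_sq {a : ℝ} (ha : a ≠ 0) : 0 < Real.sign a * a ∧ Real.sign a ^ 2 = 1 := by
  refine ⟨Real.sign_mul_pos_of_ne_zero a ha, ?_⟩
  rcases Real.sign_apply_eq_of_ne_zero a ha with h | h <;> simp [h]

theorem summable_step_sq_mul (J : ℝ) : Summable fun n => step (n + 1) ^ 2 * J := by
  refine Summable.mul_right J ?_
  have := (summable_nat_add_iff 1).2 (Real.summable_nat_pow_inv.2 one_lt_two)
  simpa [step] using this

theorem tendsto_step : Tendsto (fun n => step (n + 1)) atTop (𝓝 0) :=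
  tendsto_one_div_add_atTop_nhds_zero_nat.congr fun n => by simp [step]

end Limits

end ShiftModel

/-! ### The main theorem. -/

open ShiftModel

theorem theorem2p1 {Ω : Type*} [MeasurableSpace Ω] (P : Measure Ω) [IsProbabilityMeasure P]
    (X ε Y : ℕ → Ω → ℝ) (f g K : ℝ → ℝ) (θ σ α : ℝ) (θ₀ : Ω → ℝ)
    -- the observation times: i.i.d. with density `g` satisfying (H1)
    (hXmeas : ∀ n, Measurable (X n))
    (hXindep : iIndepFun X P)
    (hXlaw : ∀ n, P.map (X n) = volume.withDensity (fun x => ENNReal.ofReal (g x)))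
    (hg : ShiftModel.IsDesignDensity g)
    -- the noise: i.i.d., centered, with positive finite variance `σ ^ 2`
    (hεmeas : ∀ n, Measurable (ε n))
    (hεindep : iIndepFun ε P)
    (hεident : ∀ n, IdentDistrib (ε n) (ε 0) P P)
    (hεL2 : MemLp (ε 0) 2 P)
    (hεmean : ∫ ω, ε 0 ω ∂P = 0)
    (hσ : 0 < σ)
    (hεvar : variance (ε 0) P = σ ^ 2)
    -- the two sequences are independent
    (hXε : IndepFun (fun ω n => X n ω) (fun ω n => ε n ω) P)
    -- the regression model, with shape function satisfying (H2)
    (hf : ShiftModel.IsShape f)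
    (hf₁ : ShiftModel.firstFourier f ≠ 0)
    (hθ : |θ| < 1 / 4)
    (hY : ∀ n ω, Y n ω = f (X n ω - θ) + ε n ω)
    -- kernel and bandwidth
    (hK : ShiftModel.IsKernel K)
    (hKLip : ∃ L : NNReal, LipschitzWith L K)
    (hα0 : 0 < α) (hα1 : α < 1)
    -- the initial value, in `C`; constants are allowed, and functions of `(X 0, Y 0)`
    (hθ₀meas : Measurable θ₀)
    (hθ₀mem : ∀ ω, θ₀ ω ∈ Set.Icc (-1 / 4 : ℝ) (1 / 4))
    (hθ₀indep : IndepFun θ₀ (fun ω (n : ℕ) => (X (n + 1) ω, ε (n + 1) ω)) P) :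
    (∀ᵐ ω ∂P, Tendsto
      (fun n => ShiftModel.estimator K (ShiftModel.bandwidth α) ShiftModel.step
        (Real.sign (ShiftModel.firstFourier f)) (θ₀ ω) (fun i => X i ω) (fun i => Y i ω) n)
      atTop (𝓝 θ)) ∧
    (∀ᵐ ω ∂P, {n : ℕ |
      ShiftModel.preUpdate K (ShiftModel.bandwidth α) ShiftModel.step
        (Real.sign (ShiftModel.firstFourier f)) (fun i => X i ω) (fun i => Y i ω) n
        (ShiftModel.estimator K (ShiftModel.bandwidth α) ShiftModel.step
          (Real.sign (ShiftModel.firstFourier f)) (θ₀ ω) (fun i => X i ω) (fun i => Y i ω) n)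
        ∉ Set.Icc (-1 / 4 : ℝ) (1 / 4)}.Finite) := by
  obtain ⟨L, hL⟩ := hKLip
  obtain ⟨M, hM⟩ := hf.bounded
  obtain ⟨g₀, hg₀pos, -, -, hg₀, -⟩ := hg.exists_bounds
  have hlaw : ∀ n, P.map (X n) = designLaw g := hXlaw
  have hKm := hL.continuous.measurable
  have hM0 : 0 ≤ M := (abs_nonneg _).trans (hM 0)
  have : IsProbabilityMeasure (designLaw g) :=
    hlaw 0 ▸ Measure.isProbabilityMeasure_map (hXmeas 0).aemeasurable
  have : IsProbabilityMeasure (P.map (ε 0)) :=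
    Measure.isProbabilityMeasure_map (hεmeas 0).aemeasurable
  obtain ⟨hs1, hs2⟩ := sign_mul_pos_and_sq hf₁
  set s := Real.sign (firstFourier f)
  set h := bandwidth α
  -- The lower bound for `ĝ_n`: `g₀ / 2` from half of the kernel mass, `g₀ / 4` after averaging with
  -- the early terms, `g₀ / 8` after random fluctuations.
  set c₀ : ℝ := g₀ / 8 with hc₀
  have hc₀pos : 0 < c₀ := by positivity
  have hYm : ∀ n, Measurable (Y n) := fun n => by
    have : Y n = fun ω => f (X n ω - θ) + ε n ω := funext (hY n)
    rw [this]
    exact (hf.measurable.comp ((hXmeas n).sub_const θ)).add (hεmeas n)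
  have hν : Integrable (fun e => e) (P.map (ε 0)) :=
    (integrable_map_measure aestronglyMeasurable_id (hεmeas 0).aemeasurable).2
      (hεL2.integrable one_le_two)
  have hν0 : ∫ e, e ∂(P.map (ε 0)) = 0 :=
    (integral_map (hεmeas 0).aemeasurable aestronglyMeasurable_id).trans hεmean
  set ν := (designLaw g).prod (P.map (ε 0))
  set Z := dataSeq θ₀ X ε with hZ
  have hZm : Measurable Z := measurable_dataSeq hθ₀meas hXmeas hεmeas
  let t : Ω → ℕ → ℝ := fun ω => estimator K h step s (θ₀ ω) (fun i => X i ω) (fun i => Y i ω)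
  have htC : ∀ ω n, t ω n ∈ Set.Icc (-1 / 4 : ℝ) (1 / 4) := fun ω n => estimator_mem (hθ₀mem ω) n
  have htm : ∀ n, Measurable fun ω => t ω n :=
    measurable_estimator hKm h step s hθ₀meas (measurable_pi_lambda _ hXmeas)
      (measurable_pi_lambda _ hYm)
  have htθ : ∀ ω n, |2 * (t ω n - θ)| ≤ 1 := fun ω n => by
    obtain ⟨h1, h2⟩ := htC ω n
    obtain ⟨h3, h4⟩ := abs_lt.1 hθ
    rw [abs_le]; constructor <;> linarith
  let T : ℕ → Ω → ℝ := fun n ω =>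
    truncIncrement K f θ c₀ h (fun i => X i ω) n (t ω n) (X (n + 1) ω, ε (n + 1) ω)
  let Φ : ℕ → Ω → ℝ := fun n ω =>
    ∫ w, truncIncrement K f θ c₀ h (fun i => X i ω) n (t ω n) w ∂ν
  -- the same quantities as functions of the past of the data
  let xs : (ℕ → ℝ × ℝ) → ℕ → ℝ := fun v i => (v i).1
  let ys : (ℕ → ℝ × ℝ) → ℕ → ℝ := fun v i => f ((v i).1 - θ) + (v i).2
  have hxs : Measurable xs := by fun_prop
  have hys : Measurable ys := measurable_pi_lambda _ fun i =>
    (hf.measurable.comp (by fun_prop)).add (by fun_prop)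
  let est : ℕ → (ℕ → ℝ × ℝ) → ℝ := fun n v => estimator K h step s (v 0).1 (xs v) (ys v) n
  have hest : ∀ n, Measurable (est n) :=
    measurable_estimator hKm h step s (measurable_pi_apply 0).fst hxs hys
  let ψ : ℕ → (ℕ → ℝ × ℝ) → ℝ × ℝ → ℝ := fun n v w => 2 * (est n v - θ) * (s * step (n + 1) *
    (truncIncrement K f θ c₀ h (xs v) n (est n v) w -
      ∫ w', truncIncrement K f θ c₀ h (xs v) n (est n v) w' ∂ν))
  have hτm : ∀ n, Measurable fun p : (ℕ → ℝ × ℝ) × ℝ × ℝ =>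
      truncIncrement K f θ c₀ h (xs p.1) n (est n p.1) p.2 := fun n =>
    measurable_truncIncrement hKm hf.measurable h n (hxs.comp measurable_fst)
      ((hest n).comp measurable_fst) measurable_snd
  have hψm : ∀ n, Measurable (Function.uncurry (ψ n)) := fun n => by
    have h1 : Measurable fun v => ∫ w', truncIncrement K f θ c₀ h (xs v) n (est n v) w' ∂ν :=
      (hτm n).stronglyMeasurable.integral_prod_right.measurable
    exact ((((hest n).comp measurable_fst).sub_const θ).const_mul 2).mul
      (((hτm n).sub (h1.comp measurable_fst)).const_mul _)
  have hpast : ∀ n ω, ∀ i ∈ Finset.Icc 1 n, stopSeq n (Z ω) i = (X i ω, ε i ω) := by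
    intro n ω i hi
    obtain ⟨hi1, hi2⟩ := Finset.mem_Icc.1 hi
    simp [stopSeq, hZ, dataSeq, hi2, Nat.one_le_iff_ne_zero.1 hi1]
  have hxp : ∀ n ω, ∀ i ∈ Finset.Icc 1 n, xs (stopSeq n (Z ω)) i = X i ω := fun n ω i hi => by
    simp only [xs, hpast n ω i hi]
  have hestZ : ∀ n ω, est n (stopSeq n (Z ω)) = t ω n := fun n ω => by
    have h0 : (stopSeq n (Z ω) 0).1 = θ₀ ω := by simp [stopSeq, hZ, dataSeq]
    simp only [est, t, h0]
    exact estimator_congr (hxp n ω) fun i hi => by simp only [ys, hpast n ω i hi, hY]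
  have hτZ : ∀ n ω w, truncIncrement K f θ c₀ h (xs (stopSeq n (Z ω))) n (t ω n) w =
      truncIncrement K f θ c₀ h (fun i => X i ω) n (t ω n) w := fun n ω w => by
    simp only [truncIncrement, densityEst_congr (hxp n ω)]
  have hψZ : ∀ n ω, ψ n (stopSeq n (Z ω)) (Z ω (n + 1)) =
      2 * (t ω n - θ) * (s * step (n + 1) * (T n ω - Φ n ω)) := fun n ω => by
    have h0 : Z ω (n + 1) = (X (n + 1) ω, ε (n + 1) ω) := by simp [hZ, dataSeq]
    simp only [ψ, hestZ, hτZ, h0, T, Φ]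
  -- bounds
  have hτint : ∀ n x t, Integrable (truncIncrement K f θ c₀ h x n t) ν := fun n x t =>
    integrable_truncIncrement hc₀pos hKm hf.measurable hM hν h x n t
  set J₁ : ℝ := ∫ w, 1 / c₀ * (M + |w.2|) ∂ν with hJ₁
  have hJ₁0 : 0 ≤ J₁ := integral_nonneg fun w => by positivity
  have hbint : Integrable (fun w : ℝ × ℝ => 1 / c₀ * (M + |w.2|)) ν :=
    ((integrable_const M).add (hν.abs.comp_snd (designLaw g))).const_mul (1 / c₀)
  have hΦJ : ∀ n ω, |Φ n ω| ≤ J₁ := fun n ω =>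
    (Real.norm_eq_abs _).symm.trans_le <| norm_integral_le_of_norm_le hbint <|
      Eventually.of_forall fun w =>
        (Real.norm_eq_abs _).trans_le (abs_truncIncrement_le hc₀pos hM h _ n _ w)
  -- Dominates `T - Φ` by a function of the new noise alone; its second moment `J` is the same for
  -- all `n`, so the variances are summable like `step²`.
  let q : ℝ → ℝ := fun e => 1 / c₀ * (M + |e|) + J₁
  have hqm : Measurable q := by fun_prop
  set J : ℝ := ∫ e, q e ^ 2 ∂(P.map (ε 0)) with hJ
  have hqJ : ∀ n, ∫ ω, q (ε n ω) ^ 2 ∂P = J := fun n => by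
    rw [hJ, ← (hεident n).map_eq, integral_map (hεmeas n).aemeasurable
      (hqm.pow_const 2).aestronglyMeasurable]
  have hqL2 : ∀ n, MemLp (fun ω => q (ε n ω)) 2 P := fun n =>
    (((memLp_const M).add ((hεident n).memLp_iff.2 hεL2).abs).const_mul (1 / c₀)).add
      (memLp_const J₁)
  have hTq : ∀ n ω, |T n ω| ≤ 1 / c₀ * (M + |ε (n + 1) ω|) := fun n ω =>
    abs_truncIncrement_le hc₀pos hM h _ n _ _
  have hstep : ∀ n, 0 ≤ step (n + 1) := fun n => by unfold step; positivity
  have hs3 : |s| = 1 := by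
    rw [← sq_eq_sq₀ (abs_nonneg _) zero_le_one, sq_abs, hs2, one_pow]
  have hψL2 : ∀ n, MemLp (fun ω => ψ n (stopSeq n (Z ω)) (Z ω (n + 1))) 2 P ∧
      ∫ ω, ψ n (stopSeq n (Z ω)) (Z ω (n + 1)) ^ 2 ∂P ≤ step (n + 1) ^ 2 * J := fun n => by
    rw [← hqJ (n + 1)]
    refine memLp_two_and_integral_sq_le ((hψm n).comp
      (((measurable_stopSeq n).comp hZm).prodMk ((measurable_pi_apply (n + 1)).comp hZm)))
      (hqL2 (n + 1)) fun ω => ?_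
    rw [hψZ, abs_mul, abs_mul (s * step (n + 1)), abs_mul s, hs3, one_mul, abs_of_nonneg (hstep n)]
    have h1 : |T n ω - Φ n ω| ≤ q (ε (n + 1) ω) :=
      (abs_sub _ _).trans (add_le_add (hTq n ω) (hΦJ n ω))
    calc _ ≤ 1 * (step (n + 1) * q (ε (n + 1) ω)) :=
          mul_le_mul (htθ ω n) (mul_le_mul_of_nonneg_left h1 (hstep n))
            (mul_nonneg (hstep n) (abs_nonneg _)) zero_le_one
      _ = _ := one_mul _
  have hTL2 : ∀ n, MemLp (fun ω => step (n + 1) * T n ω) 2 P ∧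
      ∫ ω, (step (n + 1) * T n ω) ^ 2 ∂P ≤ step (n + 1) ^ 2 * J := fun n => by
    rw [← hqJ (n + 1)]
    refine memLp_two_and_integral_sq_le ((measurable_truncIncrement hKm hf.measurable h n
      (measurable_pi_lambda _ hXmeas) (htm n)
      ((hXmeas (n + 1)).prodMk (hεmeas (n + 1)))).const_mul _) (hqL2 (n + 1)) fun ω => ?_
    rw [abs_mul, abs_of_nonneg (hstep n)]
    exact mul_le_mul_of_nonneg_left ((hTq n ω).trans (le_add_of_nonneg_right hJ₁0)) (hstep n)
  have hmart := ae_exists_tendsto_sum_of_indepFun_past hZm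
    (indepFun_stopSeq_dataSeq hθ₀meas hXmeas hεmeas hXindep hεindep hXε hθ₀indep) hψm
    (fun n => (hψL2 n).1) (fun n v => by
      rw [map_dataSeq hXmeas hεmeas hlaw hεident hXε n]
      simp only [ψ]
      rw [integral_const_mul, integral_const_mul, integral_sub (hτint n _ _) (integrable_const _)]
      simp [ν]) (summable_step_sq_mul J) fun n => (hψL2 n).2
  have hsq := ae_summable_of_summable_integral (P := P) (fun n => (hTL2 n).1.integrable_sq)
    (fun n ω => sq_nonneg _) (summable_step_sq_mul J) fun n => (hTL2 n).2
  have hmem : ∀ᵐ ω ∂P, ∀ n, X n ω ∈ Set.Icc (-1 / 2 : ℝ) (1 / 2) := ae_all_iff.2 fun n =>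
    ae_of_ae_map (hXmeas n).aemeasurable ((hlaw n).symm ▸ hg.ae_mem_Icc)
  have key : ∀ᵐ ω ∂P, Tendsto (t ω) atTop (𝓝 θ) ∧ ∀ᶠ n in atTop,
      preUpdate K h step s (fun i => X i ω) (fun i => Y i ω) n (t ω n) ∈
        Set.Icc (-1 / 4 : ℝ) (1 / 4) := by
    filter_upwards [hmart, hsq, hmem, ae_tendsto_densityEst hXmeas hXindep hlaw hg hK hL hα0 hα1
      hg₀pos hg₀] with ω ⟨l, hl⟩ hsqω hmemω ⟨hlim, hlow⟩
    -- The truncation is eventually inactive along the path: the lower bound holds on the whole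
    -- support, which contains every observation time. So `T` drives the actual algorithm from some
    -- time on.
    have hpre : ∀ᶠ n in atTop, preUpdate K h step s (fun i => X i ω) (fun i => Y i ω) n (t ω n) =
        t ω n + s * step (n + 1) * T n ω := by
      filter_upwards [hlow] with n hn
      rw [preUpdate, increment_eq_truncIncrement (ε := fun i => ε i ω) (hY (n + 1) ω)
        (hn _ (hmemω (n + 1)))]
    have hη : Tendsto (fun n => M * ratioError K g c₀ h (fun i => X i ω) n) atTop (𝓝 0) := by
      simpa using (tendsto_ratioError hg hKm hc₀pos
        (fun x hx => le_trans (by rw [hc₀]; linarith) (hg₀ x hx)) hlim).const_mul M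
    simp only [hψZ] at hl
    obtain ⟨h1, h2⟩ := tendsto_of_projected_recursion (t := t ω) (T := fun n => T n ω)
      (Φ := fun n => Φ n ω) (γ := fun n => step (n + 1)) hs2 hs1 hθ (htC ω)
      (hpre.mono fun n hn => by rw [← hn]; rfl) hstep tendsto_step tendsto_sum_step
      (Eventually.of_forall fun n =>
        abs_integral_truncIncrement_sub_le hg hf hc₀pos hKm hM hν hν0 h _ n _) hη hl hsqω
    exact ⟨h1, by filter_upwards [hpre, h2] with n h3 h4; rwa [h3]⟩
  refine ⟨key.mono fun ω hω => hω.1, key.mono fun ω hω => ?_⟩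
  have := hω.2
  rwa [← Nat.cofinite_eq_atTop, eventually_cofinite] at this
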